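/- Let $F$ be an algebraically closed field of characteristic $0$ and let $\mathfrak g$ be a finite-dimensional Lie algebra over $F$ with a nondegenerate symmetric bilinear form $B$ which is invariant, i.e. $B([x,y],z)=B(x,[y,z])$ for all $x,y,z\in\mathfrak g$. Assume that $(\mathfrak g,B)$ is irreducible, i.e. the only ideals $\mathfrak i$ of $\mathfrak g$ such that $B|_{\mathfrak i\times\mathfrak i}$ is nondegenerate are $0$ and $\mathfrak g$. Assume moreover that $\mathfrak g$ is neither solvable nor simple, that $\dim\mathfrak g\le 13$, and that $\mathfrak g=\mathfrak s\oplus\mathfrak r$, where $\mathfrak r$ is the solvable radical of $\mathfrak g$ and $\mathfrak s$ is a Levi subalgebra isomorphic to $\mathfrak{sl}_2(F)$. If, as a module for $\mathfrak s$, $\mathfrak g$ contains four copies of the adjoint module (i.e. a direct sum of four submodules, each isomorphic to the adjoint module of $\mathfrak s$), then $\mathfrak g$ is isomorphic, as a Lie algebra over $F$, to $\mathfrak{sl}_2(F)\otimes_F\mathcal A$ with bracket $[x\otimes a,y\otimes b]=[x,y]\otimes ab$, where $\mathcal A$ is either $F[X]/(X^4)$ or $F[X,Y]/(X^2,Y^2)$.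 -/

import Mathlib

open scoped TensorProduct

section QuadraticLieAlgebra

variable {F : Type*} [Field F] {L : Type*} [LieRing L] [LieAlgebra F L]

/-- An invariant scalar product on a Lie algebra: a nondegenerate symmetric bilinear form `B`
with `B([x,y],z) = B(x,[y,z])`. -/
structure IsInvariantScalarProduct (B : LinearMap.BilinForm F L) : Prop where
  nondegenerate : B.Nondegenerate
  symm : ∀ x y : L, B x y = B y x
  invariant : ∀ x y z : L, B ⁅x, y⁆ z = B x ⁅y, z⁆

/-- An ideal is `B`-nondegenerate if the restriction of `B` to it is nondegenerate. -/
def IsNondegenerateIdeal (B : LinearMap.BilinForm F L) (I : LieIdeal F L) : Prop :=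
  (LinearMap.BilinForm.restrict B I.toSubmodule).Nondegenerate

/-- `B`-irreducibility: the only `B`-nondegenerate ideals are the trivial ones,
`0` and the whole Lie algebra. -/
def IsIrreducibleQuadratic (B : LinearMap.BilinForm F L) : Prop :=
  ∀ I : LieIdeal F L, IsNondegenerateIdeal B I → I = ⊥ ∨ I = ⊤

/-- A Levi subalgebra: a subalgebra which is a vector space complement of the solvable radical. -/
def IsLeviSubalgebra (s : LieSubalgebra F L) : Prop :=
  IsCompl s.toSubmodule (LieAlgebra.radical F L).toSubmodule

/-- As a module for the subalgebra `s`, the Lie algebra contains `n` copies of the adjoint module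
of `s`: there are `n` submodules isomorphic to the adjoint module whose sum is direct. -/
def ContainsAdjointCopies (s : LieSubalgebra F L) (n : ℕ) : Prop :=
  ∃ N : Fin n → LieSubmodule F s L, iSupIndep N ∧ ∀ i, Nonempty (N i ≃ₗ⁅F,s⁆ s)

end QuadraticLieAlgebra

section Models

variable (F : Type*) [Field F]

/-- The Lie algebra `sl₂(F)` of trace zero `2 × 2` matrices. -/
abbrev SL2 : Type _ := LieAlgebra.SpecialLinear.sl (Fin 2) F

/-- The algebra `F[X]/(X⁴)`. -/
abbrev TruncPoly : Type _ :=
  Polynomial F ⧸ (Ideal.span {(Polynomial.X : Polynomial F) ^ 4} : Ideal (Polynomial F))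

/-- The algebra `F[X,Y]/(X²,Y²)`. -/
abbrev TruncBiPoly : Type _ :=
  MvPolynomial (Fin 2) F ⧸
    (Ideal.span {(MvPolynomial.X 0 : MvPolynomial (Fin 2) F) ^ 2, MvPolynomial.X 1 ^ 2} :
      Ideal (MvPolynomial (Fin 2) F))

/-- The current Lie algebra `sl₂(F) ⊗ A` of a commutative algebra `A`, seen as a Lie algebra
over `F`, with bracket `[a ⊗ x, b ⊗ y] = ab ⊗ [x, y]` (the factors are written in the order
`A ⊗ sl₂(F)`). -/
abbrev SL2Tensor (A : Type*) [CommRing A] [Algebra F A] : Type _ := A ⊗[F] SL2 F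

end Models

/-!
Let `e, h, f` be an `sl₂`-triple spanning the Levi subalgebra. The four copies of the adjoint module
fill twelve of the at most thirteen dimensions of `L`. Since `sl₂` is perfect, it acts trivially on
the remaining quotient, and invariance of `B` turns this into a complement `Z` of invariants, of
dimension `finrank L - 12 ≤ 1` (`exists_isSl2Decomposition`).

The adjoint part is recovered from the four-dimensional space `K` of highest weight vectors, on
which `a * b = ½ ⁅a, ⁅f, b⁆⁆` is a commutative product with unit `e`. The form
`(a, b) ↦ B(⁅f, a⁆, ⁅f, b⁆)` is symmetric, nondegenerate and associative for it. The commutator of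
two multiplications is `¼ ad ⁅⁅f, a⁆, ⁅f, b⁆⁆`, where the inner bracket lies in `Z`. Moreover
`K = F e ⊕ N`, where `N` consists of the highest weight vectors in the radical, and squaring an
element of `N` moves it one step down the derived series, so that iterated squares in `N` vanish.

If `Z` is spanned by one vector `d`, then `D = ad d` is a skew derivation of `K`, and associativity
fails by a nonzero multiple of `β(a, D b) D c`. The lemma `skewDerivation_eq_zero` shows that this
forces `D = 0`. Then `F d` is a central ideal on which `B` is nondegenerate, contrary to
irreducibility (`IsSl2Decomposition.not_isIrreducibleQuadratic`).

If `Z = 0`, then `K` is a commutative associative local Frobenius algebra of dimension four and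
`L ≅ K ⊗ sl₂` (`IsSl2Decomposition.nonempty_lieEquiv_sl2Tensor`). Such algebras are classified in
`frobenius_algebra_four_classification`: an element of `N` with nonzero cube generates
`F[X]/(X⁴)`; otherwise `N³ = 0`, and a hyperbolic pair for the form generates `F[X,Y]/(X²,Y²)`.
-/

/-! ### Four-dimensional local Frobenius algebras -/

theorem linearIndependent_one_pow_of_pow_four_eq_zero {F R : Type*} [Field F] [CommRing R]
    [Algebra F R] {u : R} (h4 : u ^ 4 = 0) (h3 : u ^ 3 ≠ 0) :
    LinearIndependent F ![1, u, u ^ 2, u ^ 3] := by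
  rw [Fintype.linearIndependent_iff]
  intro c hc
  simp only [Fin.sum_univ_four, Matrix.cons_val] at hc
  have key : ∀ (a : F), a • u ^ 3 = 0 → a = 0 := fun a ha => (smul_eq_zero.1 ha).resolve_right h3
  simp only [Algebra.smul_def] at hc key
  have c0 : c 0 = 0 := key _ (by
    linear_combination u ^ 3 * hc - (algebraMap F R (c 1) + algebraMap F R (c 2) * u
      + algebraMap F R (c 3) * u ^ 2) * h4)
  rw [c0] at hc
  simp only [map_zero] at hc
  have c1 : c 1 = 0 := key _ (by
    linear_combination u ^ 2 * hc - (algebraMap F R (c 2) + algebraMap F R (c 3) * u) * h4)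
  rw [c1] at hc
  simp only [map_zero] at hc
  have c2 : c 2 = 0 := key _ (by linear_combination u * hc - algebraMap F R (c 3) * h4)
  rw [c2] at hc
  simp only [map_zero] at hc
  have c3 : c 3 = 0 := key _ (by linear_combination hc)
  intro i
  fin_cases i <;> assumption

theorem linearIndependent_one_of_sq_eq_zero {F R : Type*} [Field F] [CommRing R]
    [Algebra F R] {u v : R} (hu : u ^ 2 = 0) (hv : v ^ 2 = 0) (huv : u * v ≠ 0) :
    LinearIndependent F ![1, u, v, u * v] := by
  rw [Fintype.linearIndependent_iff]
  intro c hc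
  simp only [Fin.sum_univ_four, Matrix.cons_val] at hc
  have key : ∀ (a : F), a • (u * v) = 0 → a = 0 :=
    fun a ha => (smul_eq_zero.1 ha).resolve_right huv
  simp only [Algebra.smul_def] at hc key
  have c0 : c 0 = 0 := key _ (by
    linear_combination u * v * hc - (algebraMap F R (c 1) * v + algebraMap F R (c 3) * v ^ 2) * hu
      - algebraMap F R (c 2) * u * hv)
  rw [c0] at hc
  simp only [map_zero] at hc
  have c1 : c 1 = 0 := key _ (by
    linear_combination v * hc - (algebraMap F R (c 2) + algebraMap F R (c 3) * u) * hv)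
  have c2 : c 2 = 0 := key _ (by
    linear_combination u * hc - (algebraMap F R (c 1) + algebraMap F R (c 3) * v) * hu)
  rw [c1, c2] at hc
  simp only [map_zero] at hc
  have c3 : c 3 = 0 := key _ (by linear_combination hc)
  intro i
  fin_cases i <;> assumption

theorem finrank_truncPoly (F : Type*) [Field F] : Module.finrank F (TruncPoly F) = 4 := by
  rw [finrank_quotient_span_eq_natDegree, Polynomial.natDegree_X_pow]

instance (F : Type*) [Field F] : FiniteDimensional F (TruncPoly F) :=
  Module.finite_of_finrank_pos (by rw [finrank_truncPoly]; norm_num)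

/-- The monomials `1, X, Y, XY` span `F[X,Y]/(X²,Y²)`: their span contains `1` and is stable under
multiplication by `X` and by `Y`. -/
theorem span_monomials_truncBiPoly (F : Type*) [Field F] :
    Submodule.span F (Set.range (![1, Ideal.Quotient.mk _ (MvPolynomial.X 0),
      Ideal.Quotient.mk _ (MvPolynomial.X 1),
      Ideal.Quotient.mk _ (MvPolynomial.X 0) * Ideal.Quotient.mk _ (MvPolynomial.X 1)] :
        Fin 4 → TruncBiPoly F)) = ⊤ := by
  set x : TruncBiPoly F := Ideal.Quotient.mk _ (MvPolynomial.X 0) with hx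
  set y : TruncBiPoly F := Ideal.Quotient.mk _ (MvPolynomial.X 1) with hy
  have hx2 : x ^ 2 = 0 := by
    rw [hx, ← map_pow]
    exact Ideal.Quotient.eq_zero_iff_mem.2 (Ideal.subset_span (by simp))
  have hy2 : y ^ 2 = 0 := by
    rw [hy, ← map_pow]
    exact Ideal.Quotient.eq_zero_iff_mem.2 (Ideal.subset_span (by simp))
  set S := Submodule.span F (Set.range ![1, x, y, x * y]) with hS
  have m (i : Fin 4) : ![1, x, y, x * y] i ∈ S := Submodule.subset_span ⟨i, rfl⟩
  have m0 : (1 : TruncBiPoly F) ∈ S := m 0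
  have m1 : x ∈ S := m 1
  have m2 : y ∈ S := m 2
  have m3 : x * y ∈ S := m 3
  have stable : ∀ z : TruncBiPoly F, z ∈ S → z * x ∈ S ∧ z * y ∈ S := by
    intro z hz
    induction hz using Submodule.span_induction with
    | zero => simp
    | add a b _ _ ha hb => simpa only [add_mul] using ⟨S.add_mem ha.1 hb.1, S.add_mem ha.2 hb.2⟩
    | smul c a _ ha =>
      simpa only [smul_mul_assoc] using ⟨S.smul_mem c ha.1, S.smul_mem c ha.2⟩
    | mem a ha =>
      obtain ⟨i, rfl⟩ := ha
      fin_cases i <;> simp only [Fin.mk_one, Fin.zero_eta, Fin.reduceFinMk, Matrix.cons_val]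
      · simpa using ⟨m1, m2⟩
      · exact ⟨by rw [← sq, hx2]; exact S.zero_mem, m3⟩
      · exact ⟨by rw [mul_comm]; exact m3, by rw [← sq, hy2]; exact S.zero_mem⟩
      · refine ⟨?_, ?_⟩
        · rw [show x * y * x = y * x ^ 2 by ring, hx2, mul_zero]; exact S.zero_mem
        · rw [show x * y * y = x * y ^ 2 by ring, hy2, mul_zero]; exact S.zero_mem
  rw [eq_top_iff]
  rintro z -
  obtain ⟨p, rfl⟩ := Ideal.Quotient.mk_surjective z
  induction p using MvPolynomial.induction_on with
  | C a =>
    have : (Ideal.Quotient.mk _ (MvPolynomial.C a) : TruncBiPoly F) = a • 1 := by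
      rw [← MvPolynomial.algebraMap_eq, Ideal.Quotient.mk_algebraMap,
        Algebra.algebraMap_eq_smul_one]
    rw [this]
    exact S.smul_mem _ m0
  | add p q hp hq => rw [map_add]; exact S.add_mem hp hq
  | mul_X p i hp =>
    rw [map_mul]
    fin_cases i
    · exact (stable _ hp).1
    · exact (stable _ hp).2

theorem finrank_truncBiPoly_le (F : Type*) [Field F] : Module.finrank F (TruncBiPoly F) ≤ 4 := by
  have := finrank_range_le_card (R := F) (![1, Ideal.Quotient.mk _ (MvPolynomial.X 0),
      Ideal.Quotient.mk _ (MvPolynomial.X 1),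
      Ideal.Quotient.mk _ (MvPolynomial.X 0) * Ideal.Quotient.mk _ (MvPolynomial.X 1)] :
        Fin 4 → TruncBiPoly F)
  rwa [Set.finrank, span_monomials_truncBiPoly, finrank_top, Fintype.card_fin] at this

instance (F : Type*) [Field F] : FiniteDimensional F (TruncBiPoly F) :=
  Module.finite_def.2 (span_monomials_truncBiPoly F ▸ Submodule.fg_span (Set.finite_range _))

/-- An algebra homomorphism into a four-dimensional algebra from one of dimension at most four is
an isomorphism as soon as its range contains four linearly independent elements. -/
theorem nonempty_algEquiv_of_linearIndependent {F P R : Type*} [Field F] [CommRing P] [Algebra F P]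
    [FiniteDimensional F P] [CommRing R] [Algebra F R] (hP : Module.finrank F P ≤ 4)
    (hR : Module.finrank F R = 4) (g : P →ₐ[F] R) (b : Fin 4 → R)
    (hb : LinearIndependent F b) (hg : ∀ i, b i ∈ g.range) : Nonempty (P ≃ₐ[F] R) := by
  have : FiniteDimensional F R := Module.finite_of_finrank_pos (by omega)
  have hspan := hb.span_eq_top_of_card_eq_finrank' (by simp [hR])
  have hr : LinearMap.range g.toLinearMap = ⊤ := by
    rw [eq_top_iff, ← hspan, Submodule.span_le]
    rintro _ ⟨i, rfl⟩
    exact hg i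
  have hsurj : Function.Surjective g := LinearMap.range_eq_top.1 hr
  have hdim : Module.finrank F P = Module.finrank F R := by
    have := LinearMap.finrank_range_le g.toLinearMap
    rw [hr, finrank_top] at this
    omega
  have hinj : Function.Injective g :=
    (LinearMap.injective_iff_surjective_of_finrank_eq_finrank (f := g.toLinearMap) hdim).2 hsurj
  exact ⟨AlgEquiv.ofBijective g ⟨hinj, hsurj⟩⟩

theorem nonempty_truncPoly_algEquiv {F R : Type*} [Field F] [CommRing R] [Algebra F R]
    (hR : Module.finrank F R = 4) {u : R} (h4 : u ^ 4 = 0) (h3 : u ^ 3 ≠ 0) :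
    Nonempty (TruncPoly F ≃ₐ[F] R) := by
  have hker : ∀ a ∈ Ideal.span {(Polynomial.X : Polynomial F) ^ 4},
      Polynomial.aeval u a = 0 := by
    intro a ha
    obtain ⟨b, rfl⟩ := Ideal.mem_span_singleton.1 ha
    simp [h4]
  let g : TruncPoly F →ₐ[F] R := Ideal.Quotient.liftₐ _ (Polynomial.aeval u) hker
  have hu : u ∈ g.range := ⟨Ideal.Quotient.mk _ Polynomial.X, Polynomial.aeval_X u⟩
  refine nonempty_algEquiv_of_linearIndependent (finrank_truncPoly F).le hR g _
    (linearIndependent_one_pow_of_pow_four_eq_zero h4 h3) fun i => ?_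
  fin_cases i
  · exact g.range.one_mem
  · exact hu
  · exact g.range.pow_mem hu 2
  · exact g.range.pow_mem hu 3

theorem nonempty_truncBiPoly_algEquiv {F R : Type*} [Field F] [CommRing R] [Algebra F R]
    (hR : Module.finrank F R = 4) {u v : R} (hu : u ^ 2 = 0) (hv : v ^ 2 = 0) (huv : u * v ≠ 0) :
    Nonempty (TruncBiPoly F ≃ₐ[F] R) := by
  have hker : ∀ a ∈ (Ideal.span {(MvPolynomial.X 0 : MvPolynomial (Fin 2) F) ^ 2,
      MvPolynomial.X 1 ^ 2} : Ideal (MvPolynomial (Fin 2) F)),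
      MvPolynomial.aeval ![u, v] a = 0 := by
    intro a ha
    obtain ⟨b, c, rfl⟩ := Ideal.mem_span_pair.1 ha
    simp [hu, hv]
  let g : TruncBiPoly F →ₐ[F] R := Ideal.Quotient.liftₐ _ (MvPolynomial.aeval ![u, v]) hker
  have mu : u ∈ g.range := ⟨Ideal.Quotient.mk _ (MvPolynomial.X 0), MvPolynomial.aeval_X ![u, v] 0⟩
  have mv : v ∈ g.range := ⟨Ideal.Quotient.mk _ (MvPolynomial.X 1), MvPolynomial.aeval_X ![u, v] 1⟩
  refine nonempty_algEquiv_of_linearIndependent (finrank_truncBiPoly_le F) hR g _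
    (linearIndependent_one_of_sq_eq_zero hu hv huv) fun i => ?_
  fin_cases i
  · exact g.range.one_mem
  · exact mu
  · exact mv
  · exact g.range.mul_mem mu mv

section BilinearForm

variable {F V : Type*} [Field F] [AddCommGroup V] [Module F V] [FiniteDimensional F V]

/-- A subspace `N` complementary to a line in a nondegenerate quadratic space has a radical of
dimension at most one, so that outside this radical a linear condition on `N` still has a
solution. -/
theorem exists_mem_apply_eq_zero_and_pairing_ne_zero (hV : Module.finrank F V = 4)
    (β : LinearMap.BilinForm F V) (hnd : ∀ x, (∀ y, β x y = 0) → x = 0) (e : V)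
    (N : Submodule F V) (hN : ∀ x, ∃ c : F, x - c • e ∈ N) (φ : V →ₗ[F] F) :
    ∃ n ∈ N, φ n = 0 ∧ ∃ w ∈ N, β n w ≠ 0 := by
  have hsup : Submodule.span F {e} ⊔ N = ⊤ := by
    rw [eq_top_iff]
    rintro x -
    obtain ⟨c, hc⟩ := hN x
    rw [← add_sub_cancel (c • e) x]
    exact Submodule.add_mem_sup (Submodule.smul_mem _ _ (Submodule.mem_span_singleton_self e)) hc
  have h3 : 3 ≤ Module.finrank F N := by
    have h := Submodule.finrank_add_le_finrank_add_finrank (Submodule.span F {e}) N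
    rw [hsup, finrank_top, hV] at h
    have h1 : Module.finrank F (Submodule.span F {e}) ≤ 1 := by
      simpa using finrank_span_le_card (R := F) {e}
    omega
  let ψ : N →ₗ[F] F × F := ((φ.prod (β.flip e)).comp N.subtype)
  obtain ⟨n, hn, hn0⟩ := Submodule.exists_mem_ne_zero_of_ne_bot
    (LinearMap.ker_ne_bot_of_finrank_lt (f := ψ) (by
      rw [Module.finrank_prod, Module.finrank_self]; omega))
  have hn' : φ n = 0 ∧ β n e = 0 := by simpa [ψ] using hn
  refine ⟨n, n.2, hn'.1, ?_⟩
  by_contra! hw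
  refine hn0 (Subtype.ext (hnd n fun y => ?_))
  obtain ⟨c, hc⟩ := hN y
  rw [← sub_add_cancel y (c • e), map_add, hw _ hc, map_smul, hn'.2, smul_zero, zero_add]

/-- Over an algebraically closed field such a subspace contains an isotropic vector outside its
radical. -/
theorem exists_isotropic_pairing_ne_zero [IsAlgClosed F] (hV : Module.finrank F V = 4)
    (β : LinearMap.BilinForm F V) (hnd : ∀ x, (∀ y, β x y = 0) → x = 0)
    (hsymm : ∀ x y, β x y = β y x) (e : V)
    (N : Submodule F V) (hN : ∀ x, ∃ c : F, x - c • e ∈ N) :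
    ∃ u ∈ N, β u u = 0 ∧ ∃ w ∈ N, β u w ≠ 0 := by
  by_cases h : ∀ x ∈ N, β x x = 0
  · obtain ⟨n, hn, -, hw⟩ := exists_mem_apply_eq_zero_and_pairing_ne_zero hV β hnd e N hN 0
    exact ⟨n, hn, h n hn, hw⟩
  · push Not at h
    obtain ⟨x, hx, hxx⟩ := h
    obtain ⟨y, hy, hxy, hw⟩ := exists_mem_apply_eq_zero_and_pairing_ne_zero hV β hnd e N hN (β x)
    -- a root `t` of `β x x * t ^ 2 + β y y` makes the sum `y + t • x` isotropic
    obtain ⟨t, ht⟩ := IsAlgClosed.exists_pow_nat_eq (-(β y y) / β x x) (n := 2) (by norm_num)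
    rw [eq_div_iff hxx] at ht
    by_cases ht0 : t = 0
    · refine ⟨y, hy, ?_, hw⟩
      rw [ht0] at ht
      linear_combination ht
    · refine ⟨y + t • x, N.add_mem hy (N.smul_mem _ hx), ?_, x, hx, ?_⟩
      · simp only [map_add, map_smul, LinearMap.add_apply, LinearMap.smul_apply, smul_eq_mul,
          hsymm y x, hxy]
        linear_combination ht
      · simp only [map_add, map_smul, LinearMap.add_apply, LinearMap.smul_apply, smul_eq_mul,
          hsymm y x, hxy, zero_add]
        exact mul_ne_zero ht0 hxx

end BilinearForm

/-- A four-dimensional local algebra with a nondegenerate associative form has Hilbert function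
`(1,1,1,1)`, if some element of the maximal ideal has a nonzero cube, or else `(1,2,1)`; in the
second case an isotropic basis of the middle layer consists of square-zero elements. -/
theorem frobenius_algebra_four_classification {F R : Type*} [Field F] [IsAlgClosed F] [CharZero F]
    [CommRing R] [Algebra F R] (hR : Module.finrank F R = 4) (N : Ideal R)
    (hN : ∀ x, ∃ c : F, x - c • 1 ∈ N) (hnil : ∀ n ∈ N, IsNilpotent n)
    (β : LinearMap.BilinForm F R) (hnd : ∀ x, (∀ y, β x y = 0) → x = 0)
    (hsymm : ∀ x y, β x y = β y x) (hassoc : ∀ x y z, β (x * y) z = β x (y * z)) :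
    Nonempty (TruncPoly F ≃ₐ[F] R) ∨ Nonempty (TruncBiPoly F ≃ₐ[F] R) := by
  have : FiniteDimensional F R := Module.finite_of_finrank_pos (by omega)
  by_cases h : ∃ n ∈ N, n ^ 3 ≠ 0
  · left
    obtain ⟨n, hn, hn3⟩ := h
    refine nonempty_truncPoly_algEquiv hR (u := n) ?_ hn3
    -- a nilpotent endomorphism of a four-dimensional space has fourth power zero
    obtain ⟨k, hk⟩ := hnil n hn
    have h1 : (1 : R) ∈ LinearMap.ker ((LinearMap.mulLeft F n) ^ k) := by
      simp [LinearMap.pow_mulLeft, hk]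
    simpa [LinearMap.pow_mulLeft, hR] using
      Module.End.ker_pow_le_ker_pow_finrank (LinearMap.mulLeft F n) k h1
  · right
    push Not at h
    have h2 : (2 : R) = algebraMap F R 2 := (map_ofNat _ 2).symm
    have hc : ∀ (a : F), a ≠ 0 → ∀ x : R, algebraMap F R a * x = 0 → x = 0 := by
      intro a ha x hx
      rw [← Algebra.smul_def] at hx
      exact (smul_eq_zero.1 hx).resolve_left ha
    -- polarization of `n ^ 3 = 0` gives `N ^ 3 = 0`
    have hsq : ∀ x ∈ N, ∀ y ∈ N, x ^ 2 * y = 0 := by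
      intro x hx y hy
      refine hc 6 (by norm_num) _ ?_
      have e1 := h _ (N.add_mem hx hy)
      have e2 := h _ (N.sub_mem hx hy)
      have e3 := h _ hy
      rw [map_ofNat]
      linear_combination e1 - e2 - 2 * e3
    have hmul : ∀ x ∈ N, ∀ y ∈ N, ∀ z ∈ N, x * y * z = 0 := by
      intro x hx y hy z hz
      refine hc 2 (by norm_num) _ ?_
      have e1 := hsq _ (N.add_mem hx hy) z hz
      have e2 := hsq _ hx z hz
      have e3 := hsq _ hy z hz
      rw [← h2]
      linear_combination e1 - e2 - e3
    -- `u ^ 2` is orthogonal to `N` since `N ^ 3 = 0`, and to `1` if `u` is isotropic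
    have hzero : ∀ u ∈ N, β u u = 0 → u ^ 2 = 0 := by
      intro u hu hβ
      refine hnd _ fun y => ?_
      obtain ⟨c, hc⟩ := hN y
      have h0 : β (u * u) (y - c • 1) = 0 := by
        rw [← mul_one (y - c • 1), ← hassoc, hmul u hu u hu _ hc, map_zero, LinearMap.zero_apply]
      rw [← sub_add_cancel y (c • 1), map_add, map_smul, sq, h0, hassoc, mul_one, hβ, smul_zero,
        add_zero]
    obtain ⟨u, hu, huu, w, hw, huw⟩ := exists_isotropic_pairing_ne_zero hR β hnd hsymm 1
      (N.restrictScalars F) hN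
    let v := w - (β w w / (2 * β u w)) • u
    have hv : v ∈ N := N.sub_mem hw ((N.restrictScalars F).smul_mem _ hu)
    have hvv : β v v = 0 := by
      simp only [v, map_sub, map_smul, LinearMap.sub_apply, LinearMap.smul_apply, smul_eq_mul,
        huu, hsymm w u]
      field_simp
      ring
    have huv : β u v ≠ 0 := by simpa [v, huu] using huw
    refine nonempty_truncBiPoly_algEquiv hR (hzero u hu huu) (hzero v hv hvv) fun h0 => huv ?_
    rw [← mul_one v, ← hassoc, h0, map_zero, LinearMap.zero_apply]

/-! ### Skew derivations of commutative algebras with an invariant form -/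

section SkewDerivation

variable {F V : Type*} [Field F] [AddCommGroup V] [Module F V]

/-- Two independent vectors of a plane span it. -/
theorem exists_eq_smul_add_smul_of_finrank_eq_two (W : Submodule F V)
    (hW : Module.finrank F W = 2) {u v : V} (hu : u ∈ W) (hv : v ∈ W) (hu0 : u ≠ 0)
    (huv : ∀ a : F, a • u ≠ v) {w : V} (hw : w ∈ W) : ∃ a b : F, w = a • u + b • v := by
  have : FiniteDimensional F W := Module.finite_of_finrank_pos (by omega)
  have hli : LinearIndependent F ![(⟨u, hu⟩ : W), ⟨v, hv⟩] := by
    rw [LinearIndependent.pair_iff' (by simpa using hu0)]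
    intro a h
    exact huv a (congrArg Subtype.val h)
  have hspan := hli.span_eq_top_of_card_eq_finrank' (by simp [hW])
  have hmem : (⟨w, hw⟩ : W) ∈ Submodule.span F (Set.range ![(⟨u, hu⟩ : W), ⟨v, hv⟩]) := by
    rw [hspan]; trivial
  rw [Matrix.range_cons, Matrix.range_cons, Matrix.range_empty, Set.union_empty,
    Set.singleton_union, Submodule.mem_span_pair] at hmem
  obtain ⟨a, b, hab⟩ := hmem
  exact ⟨a, b, (congrArg Subtype.val hab).symm⟩

variable [IsAlgClosed F] [CharZero F]

/-- If the failure of associativity of a four-dimensional commutative algebra `V` is measured by a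
skew derivation `D` as in `hcurv`, then `D = 0`. With `ω` spanning the orthogonal of the maximal
ideal `N`, the derivation lives on the nondegenerate plane orthogonal to `1` and `ω`, where it is
skew, hence diagonal in an isotropic basis `u, v` with opposite eigenvalues. Comparing weights gives
`u * u = 0` and `(u * v) * u = 0`, which contradicts `hcurv` for the triple `u, v, u`. -/
theorem skewDerivation_eq_zero (hV : Module.finrank F V = 4)
    (m : V →ₗ[F] V →ₗ[F] V) (hcomm : ∀ x y, m x y = m y x) (e : V) (hone : ∀ x, m e x = x)
    (β : LinearMap.BilinForm F V) (hnd : ∀ x, (∀ y, β x y = 0) → x = 0)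
    (hsymm : ∀ x y, β x y = β y x) (hassoc : ∀ x y z, β (m x y) z = β y (m x z))
    (D : Module.End F V) (hder : ∀ x y, D (m x y) = m (D x) y + m x (D y))
    (hskew : ∀ x y, β (D x) y = -β x (D y)) (hDe : D e = 0)
    (N : Submodule F V) (hN : ∀ x, ∃ c : F, x - c • e ∈ N) (heN : e ∉ N)
    (hNm : ∀ x, ∀ n ∈ N, m x n ∈ N) (hND : ∀ n ∈ N, D n ∈ N)
    (hidem : ∀ n ∈ N, m n n = n → n = 0) (κ : F) (hκ : κ ≠ 0)
    (hcurv : ∀ x y z, m x (m y z) - m y (m x z) = (κ * β x (D y)) • D z) : D = 0 := by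
  have : FiniteDimensional F V := Module.finite_of_finrank_pos (by omega)
  -- a nonzero vector orthogonal to `N`
  obtain ⟨ω, hωN, hω0⟩ : ∃ ω : V, (∀ n ∈ N, β ω n = 0) ∧ ω ≠ 0 := by
    have hlt : Module.finrank F N < Module.finrank F V :=
      Submodule.finrank_lt (fun h => heN (h ▸ trivial))
    let ψ : V →ₗ[F] Module.Dual F N := (Submodule.dualRestrict N).comp β
    obtain ⟨ω, hω, hω0⟩ := Submodule.exists_mem_ne_zero_of_ne_bot
      (LinearMap.ker_ne_bot_of_finrank_lt (f := ψ) (by rwa [Subspace.dual_finrank_eq]))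
    exact ⟨ω, fun n hn => LinearMap.congr_fun (LinearMap.mem_ker.1 hω) ⟨n, hn⟩, hω0⟩
  have hωe : β ω e ≠ 0 := fun h => hω0 (hnd ω fun y => by
    obtain ⟨c, hc⟩ := hN y
    rw [← sub_add_cancel y (c • e), map_add, map_smul, hωN _ hc, h, smul_zero, zero_add])
  have hperp_line : ∀ x, (∀ n ∈ N, β x n = 0) → ∃ c : F, x = c • ω := by
    intro x hx
    refine ⟨β x e / β ω e, sub_eq_zero.1 (hnd _ fun y => ?_)⟩
    obtain ⟨c, hc⟩ := hN y
    rw [← sub_add_cancel y (c • e)]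
    simp only [map_add, map_smul, LinearMap.sub_apply, map_sub _ x, LinearMap.smul_apply, hx _ hc,
      hωN _ hc, smul_eq_mul]
    field_simp
    ring
  have hωm : ∀ n ∈ N, m ω n = 0 := fun n hn => hnd _ fun y => by
    rw [hcomm, hassoc, hcomm n y]
    exact hωN _ (hNm _ _ hn)
  have hNexists : ∃ n ∈ N, n ≠ 0 := by
    obtain ⟨n, hn, -, w, -, hw⟩ :=
      exists_mem_apply_eq_zero_and_pairing_ne_zero hV β hnd e N hN 0
    exact ⟨n, hn, fun h => hw (by rw [h, map_zero, LinearMap.zero_apply])⟩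
  -- otherwise `N` would have a unit element, which is idempotent
  have hω_mem : ω ∈ N := by
    obtain ⟨c, hc⟩ := hN ω
    by_cases hc0 : c = 0
    · simpa [hc0] using hc
    exfalso
    set p := -(c⁻¹ • (ω - c • e)) with hp
    have hpN : p ∈ N := N.neg_mem (N.smul_mem _ hc)
    have hpm : ∀ n ∈ N, m p n = n := by
      intro n hn
      rw [hp, map_neg, map_smul, map_sub, map_smul, LinearMap.neg_apply, LinearMap.smul_apply,
        LinearMap.sub_apply, LinearMap.smul_apply, hωm n hn, hone, zero_sub, smul_neg, neg_neg,
        inv_smul_smul₀ hc0]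
    have hp0 := hidem p hpN (hpm p hpN)
    obtain ⟨n, hn, hn0⟩ := hNexists
    exact hn0 (by rw [← hpm n hn, hp0, map_zero, LinearMap.zero_apply])
  have hωω : β ω ω = 0 := hωN ω hω_mem
  have hDω : D ω = 0 := hnd _ fun y => by
    obtain ⟨c, hc⟩ := hN y
    rw [hskew, ← sub_add_cancel y (c • e), map_add, map_smul, hDe, smul_zero, add_zero,
      hωN _ (hND _ hc), neg_zero]
  let W : Submodule F V := LinearMap.ker (β e) ⊓ LinearMap.ker (β ω)
  have hW : ∀ x, x ∈ W ↔ β e x = 0 ∧ β ω x = 0 := fun x => by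
    simp only [W, Submodule.mem_inf, LinearMap.mem_ker]
  have hsplit : ∀ y, ∃ a b : F, y - a • e - b • ω ∈ W := by
    intro y
    refine ⟨β ω y / β ω e, (β e y - β ω y / β ω e * β e e) / β ω e, (hW _).2 ?_⟩
    simp only [map_sub, map_smul, smul_eq_mul, hωω, hsymm e ω]
    constructor
    · field_simp
      ring
    · field_simp
      ring
  have hW_nd : ∀ x ∈ W, (∀ w ∈ W, β x w = 0) → x = 0 := by
    intro x hx h
    refine hnd x fun y => ?_
    obtain ⟨a, b, hab⟩ := hsplit y
    have h1 := h _ hab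
    simp only [map_sub, map_smul, smul_eq_mul, hsymm x e, hsymm x ω, ((hW x).1 hx).1,
      ((hW x).1 hx).2] at h1
    simpa using h1
  have hWN : ∀ x ∈ W, x ∈ N := by
    intro x hx
    obtain ⟨c, hc⟩ := hN x
    have h1 := hωN _ hc
    rw [map_sub, ((hW x).1 hx).2, map_smul, smul_eq_mul, zero_sub, neg_eq_zero] at h1
    simpa [(mul_eq_zero.1 h1).resolve_right hωe] using hc
  have hDW : ∀ x, D x ∈ W := fun x => (hW _).2 (by
    rw [← neg_neg (β e (D x)), ← neg_neg (β ω (D x)), ← hskew, ← hskew, hDe, hDω]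
    simp)
  have hWdim : Module.finrank F W = 2 := by
    let ψ : V →ₗ[F] F × F := (β e).prod (β ω)
    have hker : LinearMap.ker ψ = W := LinearMap.ker_prod _ _
    have hrange : LinearMap.range ψ = ⊤ := by
      rw [LinearMap.range_eq_top]
      rintro ⟨s, t⟩
      refine ⟨(t / β ω e) • e + ((s - t / β ω e * β e e) / β ω e) • ω, ?_⟩
      simp only [ψ, LinearMap.prod_apply, Function.prod_apply, map_add, map_smul, smul_eq_mul, hωω,
        hsymm e ω, Prod.smul_mk, Prod.mk_add_mk, Prod.mk.injEq]
      constructor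
      · field_simp
        ring
      · field_simp
        ring
    have := LinearMap.finrank_range_add_finrank_ker ψ
    rw [hker, hrange, finrank_top, Module.finrank_prod, Module.finrank_self, hV] at this
    omega
  have : Nontrivial W := Module.nontrivial_of_finrank_pos (R := F) (by omega)
  obtain ⟨μ, hμ⟩ := Module.End.exists_eigenvalue
    ((D.restrict (p := W) (q := W) fun x _ => hDW x) : Module.End F W)
  obtain ⟨⟨u, huW⟩, hu⟩ := hμ.exists_hasEigenvector
  have hu0 : u ≠ 0 := fun h => hu.2 (Subtype.ext h)
  have hDu : D u = μ • u := congrArg Subtype.val hu.apply_eq_smul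
  clear hu hμ
  have hD_of_W : (∀ w ∈ W, D w = 0) → D = 0 := by
    intro h
    ext y
    obtain ⟨a, b, hab⟩ := hsplit y
    have h1 := h _ hab
    rw [map_sub, map_sub, map_smul, map_smul, hDe, hDω, smul_zero, smul_zero, sub_zero,
      sub_zero] at h1
    rw [h1, LinearMap.zero_apply]
  have hself : ∀ x, β (D x) x = 0 := by
    intro x
    have h1 := hskew x x
    rw [hsymm x (D x)] at h1
    exact self_eq_neg.1 h1
  -- if `D` kills a vector of the plane `W`, skewness leaves no room for other nonzero values
  by_cases hμ0 : μ = 0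
  · rw [hμ0, zero_smul] at hDu
    obtain ⟨v, hv, huv⟩ : ∃ v ∈ W, ∀ a : F, a • u ≠ v := by
      by_contra! h
      have hle : W ≤ Submodule.span F {u} := fun v hv => Submodule.mem_span_singleton.2 (h v hv)
      have h1 := Submodule.finrank_mono hle
      rw [finrank_span_singleton hu0] at h1
      omega
    have hDv : D v = 0 := hW_nd _ (hDW v) fun w hw => by
      obtain ⟨a, b, rfl⟩ := exists_eq_smul_add_smul_of_finrank_eq_two W hWdim huW hv hu0 huv hw
      rw [map_add, map_smul, map_smul, hself, hskew v u, hDu]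
      simp
    refine hD_of_W fun w hw => ?_
    obtain ⟨a, b, rfl⟩ := exists_eq_smul_add_smul_of_finrank_eq_two W hWdim huW hv hu0 huv hw
    rw [map_add, map_smul, map_smul, hDu, hDv, smul_zero, smul_zero, add_zero]
  exfalso
  have huu : β u u = 0 := by
    have h1 := hself u
    rw [hDu, map_smul, LinearMap.smul_apply, smul_eq_mul] at h1
    exact (mul_eq_zero.1 h1).resolve_left hμ0
  obtain ⟨w, hw, huw⟩ : ∃ w ∈ W, β u w ≠ 0 := by
    by_contra! h
    exact hu0 (hW_nd u huW h)
  obtain ⟨v, hv, hvv, huv⟩ : ∃ v ∈ W, β v v = 0 ∧ β u v ≠ 0 := by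
    refine ⟨w - (β w w / (2 * β u w)) • u, W.sub_mem hw (W.smul_mem _ huW), ?_, ?_⟩
    · simp only [map_sub, map_smul, LinearMap.sub_apply, LinearMap.smul_apply, smul_eq_mul,
        huu, hsymm w u]
      field_simp
      ring
    · simpa [huu] using huw
  have hspan : ∀ x ∈ W, ∃ a b : F, x = a • u + b • v := fun x hx =>
    exists_eq_smul_add_smul_of_finrank_eq_two W hWdim huW hv hu0
      (fun a h => huv (by rw [← h, map_smul, huu, smul_zero])) hx
  have hDv : D v = -(μ • v) := by
    refine eq_neg_of_add_eq_zero_left (hW_nd _ (W.add_mem (hDW v) (W.smul_mem _ hv)) fun x hx => ?_)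
    obtain ⟨a, b, rfl⟩ := hspan x hx
    have h1 := hself v
    have h2 := hskew v u
    rw [hDu, map_smul, smul_eq_mul] at h2
    simp only [map_add, map_smul, LinearMap.add_apply, LinearMap.smul_apply, smul_eq_mul, h1, h2,
      hvv]
    ring
  -- a square in `N` lies in the plane `W` as soon as its base is isotropic
  have hsqW : ∀ x ∈ W, β x x = 0 → m x x ∈ W := fun x hx hxx => (hW _).2 (by
    rw [hsymm e, hassoc, hcomm x e, hone, hsymm ω, hassoc, hcomm x ω, hωm x (hWN x hx)]
    simpa using hxx)
  have hsq : ∀ (x y : V) (c : F), c ≠ 0 → x ∈ W → β x x = 0 → (∀ z ∈ W, ∃ a b : F,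
      z = a • x + b • y) → D x = c • x → D y = -(c • y) → m x x = 0 := by
    intro x y c hc hx hxx hxy hDx hDy
    have h0 : D (m x x) = (2 * c) • m x x := by
      rw [hder, hDx, map_smul, map_smul, LinearMap.smul_apply, ← add_smul, two_mul]
    have h1 := hskew (m x x) x
    have h2 := hskew (m x x) y
    simp only [h0, hDx, hDy, map_smul, map_neg, LinearMap.smul_apply, smul_eq_mul] at h1 h2
    have h1' : β (m x x) x = 0 := by
      have : 3 * c * β (m x x) x = 0 := by linear_combination h1
      exact (mul_eq_zero.1 this).resolve_left (mul_ne_zero three_ne_zero hc)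
    have h2' : β (m x x) y = 0 := by
      have : c * β (m x x) y = 0 := by linear_combination h2
      exact (mul_eq_zero.1 this).resolve_left hc
    refine hW_nd _ (hsqW x hx hxx) fun z hz => ?_
    obtain ⟨a, b, rfl⟩ := hxy z hz
    simp [h1', h2']
  have hmu : m u u = 0 := hsq u v μ hμ0 huW huu hspan hDu hDv
  have hmv : m v v = 0 := hsq v u (-μ) (neg_ne_zero.2 hμ0) hv hvv
    (fun z hz => by
      obtain ⟨a, b, h⟩ := hspan z hz
      exact ⟨b, a, by rw [h, add_comm]⟩)
    (by rw [hDv, neg_smul]) (by rw [hDu, neg_smul, neg_neg])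
  have huvN : ∀ n ∈ N, β (m u v) n = 0 := by
    intro n hn
    obtain ⟨a, b, hab⟩ := hsplit n
    have ha : a = 0 := by
      have h1 := ((hW _).1 hab).2
      rw [map_sub, map_sub, map_smul, map_smul, hωω, hωN n hn, smul_zero, sub_zero, zero_sub,
        neg_eq_zero, smul_eq_mul] at h1
      exact (mul_eq_zero.1 h1).resolve_right hωe
    obtain ⟨s, t, hst⟩ := hspan _ hab
    have hn' : n = s • u + t • v + b • ω := by
      rw [← hst, ha, zero_smul, sub_zero, sub_add_cancel]
    have h1 : β (m u v) u = 0 := by rw [hassoc, hmu, map_zero]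
    have h2 : β (m u v) v = 0 := by rw [hcomm, hassoc, hmv, map_zero]
    have h3 : β (m u v) ω = 0 := by rw [hassoc, hcomm, hωm u (hWN u huW), map_zero]
    rw [hn']
    simp [h1, h2, h3]
  obtain ⟨c, hc⟩ := hperp_line _ huvN
  have hfinal := hcurv u v u
  rw [hmu, map_zero, sub_zero, hcomm v u, hc, map_smul, hcomm u ω, hωm u (hWN u huW), smul_zero,
    hDu, hDv, map_neg, map_smul, smul_smul, smul_eq_mul] at hfinal
  exact smul_ne_zero (mul_ne_zero (mul_ne_zero hκ (neg_ne_zero.2 (mul_ne_zero hμ0 huv))) hμ0) hu0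
    hfinal.symm

end SkewDerivation

/-! ### Coordinates of a Lie algebra made of adjoint and trivial `sl₂`-modules -/

section Sl2Decomposition

variable {F : Type*} [Field F] {L : Type*} [LieRing L] [LieAlgebra F L]

/-- Under the adjoint action of the `sl₂`-triple `(e, h, f)`, the Lie algebra `L` is the sum of
adjoint modules, whose highest weight vectors form the space `K`, and of a space `Z` of
invariants. -/
structure IsSl2Decomposition (e h f : L) (K Z : Submodule F L) : Prop where
  lie_h_e : ⁅h, e⁆ = (2 : F) • e
  lie_h_f : ⁅h, f⁆ = (-2 : F) • f
  lie_e_f : ⁅e, f⁆ = h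
  lie_h : ∀ a ∈ K, ⁅h, a⁆ = (2 : F) • a
  lie_e : ∀ a ∈ K, ⁅e, a⁆ = 0
  lie_f_lie_f_lie_f : ∀ a ∈ K, ⁅f, ⁅f, ⁅f, a⁆⁆⁆ = 0
  lie_e_invariant : ∀ z ∈ Z, ⁅e, z⁆ = 0
  lie_f_invariant : ∀ z ∈ Z, ⁅f, z⁆ = 0
  exists_eq : ∀ x, ∃ a ∈ K, ∃ b ∈ K, ∃ c ∈ K, ∃ z ∈ Z, x = a + ⁅f, b⁆ + ⁅f, ⁅f, c⁆⁆ + z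

theorem lie_weight_add {h x y : L} {s t : F} (hx : ⁅h, x⁆ = s • x) (hy : ⁅h, y⁆ = t • y) :
    ⁅h, ⁅x, y⁆⁆ = (s + t) • ⁅x, y⁆ := by
  rw [leibniz_lie, hx, hy, smul_lie, lie_smul, add_smul]

theorem lie_h_lie_f_of_weight_two {h f a : L} (hf : ⁅h, f⁆ = (-2 : F) • f)
    (ha : ⁅h, a⁆ = (2 : F) • a) : ⁅h, ⁅f, a⁆⁆ = 0 := by
  rw [lie_weight_add hf ha, neg_add_cancel, zero_smul]

theorem lie_h_lie_f_lie_f_of_weight_two {h f a : L} (hf : ⁅h, f⁆ = (-2 : F) • f)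
    (ha : ⁅h, a⁆ = (2 : F) • a) : ⁅h, ⁅f, ⁅f, a⁆⁆⁆ = (-2 : F) • ⁅f, ⁅f, a⁆⁆ := by
  have h0 : ⁅h, ⁅f, a⁆⁆ = (0 : F) • ⁅f, a⁆ := by
    rw [lie_h_lie_f_of_weight_two hf ha, zero_smul]
  rw [lie_weight_add hf h0, add_zero]

theorem lie_e_lie_f_of_weight_two {e h f a : L} (hef : ⁅e, f⁆ = h)
    (ha : ⁅h, a⁆ = (2 : F) • a) (hea : ⁅e, a⁆ = 0) : ⁅e, ⁅f, a⁆⁆ = (2 : F) • a := by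
  rw [leibniz_lie, hef, ha, hea, lie_zero, add_zero]

theorem lie_e_lie_f_lie_f_of_weight_two {e h f a : L} (hf : ⁅h, f⁆ = (-2 : F) • f)
    (hef : ⁅e, f⁆ = h) (ha : ⁅h, a⁆ = (2 : F) • a) (hea : ⁅e, a⁆ = 0) :
    ⁅e, ⁅f, ⁅f, a⁆⁆⁆ = (2 : F) • ⁅f, a⁆ := by
  rw [leibniz_lie, hef, lie_h_lie_f_of_weight_two hf ha, lie_e_lie_f_of_weight_two hef ha hea,
    lie_smul, zero_add]

theorem IsInvariantScalarProduct.apply_lie_left {B : LinearMap.BilinForm F L}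
    (hB : IsInvariantScalarProduct B) (x y z : L) : B ⁅x, y⁆ z = -B y ⁅x, z⁆ := by
  rw [← lie_skew, map_neg, LinearMap.neg_apply, hB.invariant]

theorem IsInvariantScalarProduct.eq_zero {B : LinearMap.BilinForm F L}
    (hB : IsInvariantScalarProduct B) {x : L} (hx : ∀ y, B x y = 0) : x = 0 :=
  hB.nondegenerate.1 x hx

namespace IsSl2Decomposition

variable {e h f : L} {K Z : Submodule F L}

theorem lie_h_invariant (H : IsSl2Decomposition e h f K Z) {z : L} (hz : z ∈ Z) : ⁅h, z⁆ = 0 := by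
  rw [← H.lie_e_f, lie_lie, H.lie_e_invariant z hz, H.lie_f_invariant z hz, lie_zero, lie_zero,
    sub_zero]

theorem lie_h_lie_f (H : IsSl2Decomposition e h f K Z) {a : L} (ha : a ∈ K) : ⁅h, ⁅f, a⁆⁆ = 0 :=
  lie_h_lie_f_of_weight_two H.lie_h_f (H.lie_h a ha)

theorem lie_h_lie_f_lie_f (H : IsSl2Decomposition e h f K Z) {a : L} (ha : a ∈ K) :
    ⁅h, ⁅f, ⁅f, a⁆⁆⁆ = (-2 : F) • ⁅f, ⁅f, a⁆⁆ :=
  lie_h_lie_f_lie_f_of_weight_two H.lie_h_f (H.lie_h a ha)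

theorem lie_e_lie_f (H : IsSl2Decomposition e h f K Z) {a : L} (ha : a ∈ K) :
    ⁅e, ⁅f, a⁆⁆ = (2 : F) • a :=
  lie_e_lie_f_of_weight_two H.lie_e_f (H.lie_h a ha) (H.lie_e a ha)

theorem lie_e_lie_f_lie_f (H : IsSl2Decomposition e h f K Z) {a : L} (ha : a ∈ K) :
    ⁅e, ⁅f, ⁅f, a⁆⁆⁆ = (2 : F) • ⁅f, a⁆ :=
  lie_e_lie_f_lie_f_of_weight_two H.lie_h_f H.lie_e_f (H.lie_h a ha) (H.lie_e a ha)

/-- The operator `ad h` is annihilated by `t ^ 3 - 4 * t`, the only weights being `2, 0, -2`. -/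
theorem lie_h_cubed (H : IsSl2Decomposition e h f K Z) (x : L) :
    ⁅h, ⁅h, ⁅h, x⁆⁆⁆ = (4 : F) • ⁅h, x⁆ := by
  obtain ⟨a, ha, b, hb, c, hc, z, hz, rfl⟩ := H.exists_eq x
  simp only [lie_add, H.lie_h a ha, H.lie_h_lie_f hb, H.lie_h_lie_f_lie_f hc, H.lie_h_invariant hz,
    lie_smul, lie_zero]
  module

theorem lie_f_lie_of_mem (H : IsSl2Decomposition e h f K Z) {z : L} (hz : z ∈ Z) (x : L) :
    ⁅f, ⁅z, x⁆⁆ = ⁅z, ⁅f, x⁆⁆ := by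
  rw [leibniz_lie, H.lie_f_invariant z hz, zero_lie, zero_add]

/-- The form on the space of highest weight vectors induced by a form on `L`; it pairs the zero
weight spaces of the adjoint modules. -/
def form (f : L) (K : Submodule F L) (B : LinearMap.BilinForm F L) : LinearMap.BilinForm F K :=
  B.compl₁₂ ((LieAlgebra.ad F L f).domRestrict K) ((LieAlgebra.ad F L f).domRestrict K)

theorem form_apply (f : L) (K : Submodule F L) (B : LinearMap.BilinForm F L) (a b : K) :
    form f K B a b = B ⁅f, (a : L)⁆ ⁅f, (b : L)⁆ := rfl

variable {B : LinearMap.BilinForm F L}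

theorem form_comm (hB : IsInvariantScalarProduct B) (a b : K) : form f K B a b = form f K B b a :=
  hB.symm _ _

theorem apply_lie_f_invariant (H : IsSl2Decomposition e h f K Z) (hB : IsInvariantScalarProduct B)
    {z : L} (hz : z ∈ Z) (x : L) : B ⁅f, x⁆ z = 0 := by
  rw [hB.apply_lie_left, H.lie_f_invariant z hz, map_zero, neg_zero]

theorem eq_zero_of_weight (H : IsSl2Decomposition e h f K Z) {x : L} {t : F} (hx : ⁅h, x⁆ = t • x)
    (ht : t ^ 3 ≠ 4 * t) : x = 0 := by
  have h1 := H.lie_h_cubed x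
  simp only [hx, lie_smul, smul_smul] at h1
  rw [← sub_eq_zero, ← sub_smul] at h1
  exact (smul_eq_zero.1 h1).resolve_left fun h2 => ht (by linear_combination h2)

variable [CharZero F]

theorem eq_zero_of_lie_f_eq_zero (H : IsSl2Decomposition e h f K Z) {a : L} (ha : a ∈ K)
    (h0 : ⁅f, a⁆ = 0) : a = 0 := by
  have h1 := H.lie_e_lie_f ha
  rw [h0, lie_zero] at h1
  exact (smul_eq_zero.1 h1.symm).resolve_left two_ne_zero

theorem eq_zero_of_lie_f_lie_f_eq_zero (H : IsSl2Decomposition e h f K Z) {a : L} (ha : a ∈ K)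
    (h0 : ⁅f, ⁅f, a⁆⁆ = 0) : a = 0 := by
  have h1 := H.lie_e_lie_f_lie_f ha
  rw [h0, lie_zero] at h1
  exact H.eq_zero_of_lie_f_eq_zero ha ((smul_eq_zero.1 h1.symm).resolve_left two_ne_zero)

theorem mem_of_weight_two (H : IsSl2Decomposition e h f K Z) {x : L} (hx : ⁅h, x⁆ = (2 : F) • x) :
    x ∈ K := by
  have h1 : ⁅h, ⁅h, x⁆⁆ + (2 : F) • ⁅h, x⁆ = (8 : F) • x := by
    rw [hx, lie_smul, hx]
    module
  obtain ⟨a, ha, b, hb, c, hc, z, hz, hxe⟩ := H.exists_eq x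
  have h2 : ⁅h, ⁅h, x⁆⁆ + (2 : F) • ⁅h, x⁆ = (8 : F) • a := by
    rw [hxe]
    simp only [lie_add, H.lie_h a ha, H.lie_h_lie_f hb, H.lie_h_lie_f_lie_f hc,
      H.lie_h_invariant hz, lie_smul, lie_zero]
    module
  have h3 : x = a := by
    have h8 : (8 : F) ≠ 0 := by norm_num
    exact smul_right_injective L h8 (h1.symm.trans h2)
  rwa [h3]

/-- The invariants are the vectors of weight zero which are killed by `f`. -/
theorem mem_of_weight_zero (H : IsSl2Decomposition e h f K Z) {x : L} (hx : ⁅h, x⁆ = 0) (hfx :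
    ⁅f, x⁆ = 0) : x ∈ Z := by
  obtain ⟨a, ha, b, hb, c, hc, z, hz, hxe⟩ := H.exists_eq x
  have h1 : (4 : F) • (a + ⁅f, ⁅f, c⁆⁆) = 0 := by
    have h2 : ⁅h, ⁅h, x⁆⁆ = 0 := by rw [hx, lie_zero]
    rw [hxe] at h2
    simp only [lie_add, H.lie_h a ha, H.lie_h_lie_f hb, H.lie_h_lie_f_lie_f hc,
      H.lie_h_invariant hz, lie_smul, lie_zero] at h2
    rw [← h2]
    module
  have h3 := (smul_eq_zero.1 h1).resolve_left (by norm_num)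
  have h4 : x = ⁅f, b⁆ + z := by
    rw [hxe, ← zero_add (⁅f, b⁆ + z), ← h3]
    abel
  rw [h4, lie_add, H.lie_f_invariant z hz, add_zero] at hfx
  rw [h4, H.eq_zero_of_lie_f_lie_f_eq_zero hb hfx, lie_zero, zero_add]
  exact hz

theorem e_mem (H : IsSl2Decomposition e h f K Z) : e ∈ K := H.mem_of_weight_two H.lie_h_e

theorem lie_eq_zero (H : IsSl2Decomposition e h f K Z) {a b : L} (ha : a ∈ K) (hb : b ∈ K) :
    ⁅a, b⁆ = 0 :=
  H.eq_zero_of_weight (lie_weight_add (H.lie_h a ha) (H.lie_h b hb)) (by norm_num)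

theorem lie_lie_f_comm (H : IsSl2Decomposition e h f K Z) {a b : L} (ha : a ∈ K) (hb : b ∈ K) :
    ⁅a, ⁅f, b⁆⁆ = ⁅b, ⁅f, a⁆⁆ := by
  have h1 : ⁅f, ⁅a, b⁆⁆ = 0 := by rw [H.lie_eq_zero ha hb, lie_zero]
  rw [leibniz_lie, ← lie_skew ⁅f, a⁆ b, neg_add_eq_zero] at h1
  exact h1.symm

theorem lie_lie_f_mem (H : IsSl2Decomposition e h f K Z) {a b : L} (ha : a ∈ K) (hb : b ∈ K) :
    ⁅a, ⁅f, b⁆⁆ ∈ K := by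
  have h0 : ⁅h, ⁅f, b⁆⁆ = (0 : F) • ⁅f, b⁆ := by rw [H.lie_h_lie_f hb, zero_smul]
  refine H.mem_of_weight_two ?_
  rw [lie_weight_add (H.lie_h a ha) h0, add_zero]

/-- Applying `(ad f)³` to `⁅a, b⁆ = 0` shows that this bracket of weight zero is invariant. -/
theorem lie_lie_f_lie_f_mem (H : IsSl2Decomposition e h f K Z) {a b : L} (ha : a ∈ K) (hb : b ∈ K) :
    ⁅⁅f, a⁆, ⁅f, b⁆⁆ ∈ Z := by
  have h1 : ⁅f, ⁅f, ⁅f, ⁅a, b⁆⁆⁆⁆ = 0 := by simp only [H.lie_eq_zero ha hb, lie_zero]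
  have h2 : ⁅f, ⁅f, ⁅f, ⁅a, b⁆⁆⁆⁆ = (3 : F) • ⁅f, ⁅⁅f, a⁆, ⁅f, b⁆⁆⁆ := by
    simp only [leibniz_lie f a b, leibniz_lie f ⁅f, a⁆ b, leibniz_lie f a ⁅f, b⁆,
      leibniz_lie f ⁅f, ⁅f, a⁆⁆ b, leibniz_lie f ⁅f, a⁆ ⁅f, b⁆, leibniz_lie f a ⁅f, ⁅f, b⁆⁆,
      lie_add, H.lie_f_lie_f_lie_f a ha, H.lie_f_lie_f_lie_f b hb,
      zero_lie, lie_zero]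
    module
  rw [h2] at h1
  refine H.mem_of_weight_zero ?_ ((smul_eq_zero.1 h1).resolve_left three_ne_zero)
  rw [leibniz_lie, H.lie_h_lie_f ha, H.lie_h_lie_f hb, zero_lie, lie_zero, add_zero]

/-- The coordinate product on the space of highest weight vectors. When `L` is the current algebra
of `A`, with `a : A` identified with the highest weight vector `a ⊗ e`, it is the product of
`A`. -/
def mul (H : IsSl2Decomposition e h f K Z) : K →ₗ[F] K →ₗ[F] K :=
  LinearMap.mk₂ F
    (fun a b => ⟨(2⁻¹ : F) • ⁅(a : L), ⁅f, (b : L)⁆⁆, K.smul_mem _ (H.lie_lie_f_mem a.2 b.2)⟩)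
    (fun a b c => Subtype.ext (by simp))
    (fun r a b => Subtype.ext (by simp [smul_comm r]))
    (fun a b c => Subtype.ext (by simp))
    (fun r a b => Subtype.ext (by simp [smul_comm r]))

theorem coe_mul (H : IsSl2Decomposition e h f K Z) (a b : K) :
    (H.mul a b : L) = (2⁻¹ : F) • ⁅(a : L), ⁅f, (b : L)⁆⁆ := rfl

theorem coe_mul' (H : IsSl2Decomposition e h f K Z) (a b : K) : (H.mul a b : L) = -((2⁻¹ :
    F) • ⁅⁅f, (a : L)⁆, (b : L)⁆) := by
  rw [coe_mul, H.lie_lie_f_comm a.2 b.2, ← lie_skew, smul_neg]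

theorem mul_comm' (H : IsSl2Decomposition e h f K Z) (a b : K) : H.mul a b = H.mul b a :=
  Subtype.ext (by rw [coe_mul, coe_mul, H.lie_lie_f_comm a.2 b.2])

theorem e_mul (H : IsSl2Decomposition e h f K Z) (a : K) : H.mul ⟨e, H.e_mem⟩ a = a :=
  Subtype.ext (by
    rw [coe_mul, H.lie_e_lie_f a.2, inv_smul_smul₀ two_ne_zero])

/-- Multiplication by `a` is `-½ ad ⁅f, a⁆`, so that two multiplications commute up to the action of
the invariant `⁅⁅f, a⁆, ⁅f, b⁆⁆`. -/
theorem mul_mul_sub_mul_mul (H : IsSl2Decomposition e h f K Z) (a b c : K) :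
    ((H.mul a (H.mul b c) - H.mul b (H.mul a c) : K) : L) =
      (4⁻¹ : F) • ⁅⁅⁅f, (a : L)⁆, ⁅f, (b : L)⁆⁆, (c : L)⁆ := by
  rw [AddSubgroupClass.coe_sub, coe_mul', coe_mul', coe_mul', coe_mul',
    lie_lie ⁅f, (a : L)⁆ ⁅f, (b : L)⁆]
  simp only [lie_neg, lie_smul]
  rw [show (4 : F) = 2 * 2 by norm_num, mul_inv]
  module

/-- The derivation of the coordinate algebra given by the bracket with an invariant. -/
def der (H : IsSl2Decomposition e h f K Z) {z : L} (hz : z ∈ Z) : Module.End F K :=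
  ((LieAlgebra.ad F L z).domRestrict K).codRestrict K fun a => by
    have h0 : ⁅h, z⁆ = (0 : F) • z := by rw [H.lie_h_invariant hz, zero_smul]
    refine H.mem_of_weight_two ?_
    rw [LinearMap.domRestrict_apply, LieAlgebra.ad_apply, lie_weight_add h0 (H.lie_h a a.2),
      zero_add]

theorem coe_der (H : IsSl2Decomposition e h f K Z) {z : L} (hz : z ∈ Z) (a : K) : (H.der hz a :
    L) = ⁅z, (a : L)⁆ := rfl

theorem der_mul (H : IsSl2Decomposition e h f K Z) {z : L} (hz : z ∈ Z) (a b : K) :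
    H.der hz (H.mul a b) = H.mul (H.der hz a) b + H.mul a (H.der hz b) :=
  Subtype.ext (by
    rw [Submodule.coe_add, coe_der, coe_mul, coe_mul, coe_mul, coe_der, coe_der, lie_smul,
      leibniz_lie, H.lie_f_lie_of_mem hz, smul_add])

theorem der_e (H : IsSl2Decomposition e h f K Z) {z : L} (hz : z ∈ Z) : H.der hz ⟨e, H.e_mem⟩ = 0 :=
  Subtype.ext (by
    rw [coe_der, ← lie_skew, H.lie_e_invariant z hz, neg_zero, Submodule.coe_zero])

theorem form_mul (H : IsSl2Decomposition e h f K Z) (hB : IsInvariantScalarProduct B) (a b c : K) :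
    form f K B (H.mul a b) c = form f K B b (H.mul a c) := by
  rw [form_apply, form_apply, hB.apply_lie_left, coe_mul, coe_mul, lie_smul, map_smul, map_smul,
    LinearMap.smul_apply, hB.apply_lie_left, leibniz_lie f (a : L) ⁅f, (c : L)⁆, map_add,
    H.apply_lie_f_invariant hB (H.lie_lie_f_lie_f_mem a.2 c.2), zero_add, smul_neg, neg_neg]

theorem form_nondegenerate (H : IsSl2Decomposition e h f K Z) (hB : IsInvariantScalarProduct B) (a :
    K) (ha : ∀ b, form f K B a b = 0) : a = 0 := by
  refine Subtype.ext (H.eq_zero_of_lie_f_lie_f_eq_zero a.2 (hB.eq_zero fun x => ?_))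
  obtain ⟨b, hb, c, hc, d, hd, z, hz, rfl⟩ := H.exists_eq x
  have h1 : B ⁅f, ⁅f, (a : L)⁆⁆ b = 0 := by
    have h2 := ha ⟨b, hb⟩
    rw [form_apply] at h2
    rw [hB.apply_lie_left, h2, neg_zero]
  have h2 : B ⁅f, ⁅f, (a : L)⁆⁆ ⁅f, c⁆ = 0 := by
    rw [hB.apply_lie_left, hB.apply_lie_left, H.lie_f_lie_f_lie_f c hc, map_zero, neg_zero,
      neg_zero]
  have h3 : B ⁅f, ⁅f, (a : L)⁆⁆ ⁅f, ⁅f, d⁆⁆ = 0 := by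
    rw [hB.apply_lie_left, H.lie_f_lie_f_lie_f d hd, map_zero, neg_zero]
  rw [map_add, map_add, map_add, h1, h2, h3, H.apply_lie_f_invariant hB hz]
  simp

theorem form_der (H : IsSl2Decomposition e h f K Z) (hB : IsInvariantScalarProduct B) {z : L} (hz :
    z ∈ Z) (a b : K) :
    form f K B (H.der hz a) b = -form f K B a (H.der hz b) := by
  rw [form_apply, form_apply, coe_der, coe_der, H.lie_f_lie_of_mem hz, H.lie_f_lie_of_mem hz,
    hB.apply_lie_left]

theorem apply_lie_lie_f_lie_f (H : IsSl2Decomposition e h f K Z) (hB : IsInvariantScalarProduct B)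
    {z : L} (hz : z ∈ Z) (a b : K) :
    B ⁅⁅f, (a : L)⁆, ⁅f, (b : L)⁆⁆ z = -form f K B a (H.der hz b) := by
  rw [hB.invariant, ← lie_skew ⁅f, (b : L)⁆ z, map_neg, form_apply, coe_der, H.lie_f_lie_of_mem hz]

/-- The invariants form a nondegenerate subspace. -/
theorem eq_zero_of_mem_of_apply_eq_zero (H : IsSl2Decomposition e h f K Z) (hB :
    IsInvariantScalarProduct B) {z : L} (hz : z ∈ Z) (h0 : ∀ w ∈ Z, B z w = 0) :
    z = 0 := by
  refine hB.eq_zero fun x => ?_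
  obtain ⟨a, ha, b, hb, c, hc, w, hw, rfl⟩ := H.exists_eq x
  have h1 : B z a = 0 := by
    have h2 : (2 : F) • B z a = 0 := by
      rw [← map_smul, ← H.lie_h a ha, ← hB.invariant, ← lie_skew, H.lie_h_invariant hz, neg_zero,
        map_zero, LinearMap.zero_apply]
    exact (smul_eq_zero.1 h2).resolve_left two_ne_zero
  rw [map_add, map_add, map_add, h1, hB.symm z ⁅f, b⁆, hB.symm z ⁅f, ⁅f, c⁆⁆,
    H.apply_lie_f_invariant hB hz, H.apply_lie_f_invariant hB hz, h0 w hw]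
  simp

end IsSl2Decomposition

end Sl2Decomposition

/-! ### Existence of the decomposition -/

section Existence

variable {F : Type*} [Field F] {L : Type*} [LieRing L] [LieAlgebra F L] {e h f : L}

/-- The highest weight vectors of weight two. -/
def highestWeightSpace (F : Type*) [Field F] {L : Type*} [LieRing L] [LieAlgebra F L] (e h : L) :
    Submodule F L :=
  LinearMap.ker (LieAlgebra.ad F L h - (2 : F) • LinearMap.id) ⊓ LinearMap.ker (LieAlgebra.ad F L e)

theorem mem_highestWeightSpace {a : L} :
    a ∈ highestWeightSpace F e h ↔ ⁅h, a⁆ = (2 : F) • a ∧ ⁅e, a⁆ = 0 := by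
  simp [highestWeightSpace, sub_eq_zero]

/-- The map `(a, b, c) ↦ a + ⁅f, b⁆ + ⁅f, ⁅f, c⁆⁆` on triples of highest weight vectors. -/
def stringMap (F : Type*) [Field F] {L : Type*} [LieRing L] [LieAlgebra F L] (e h f : L) :
    highestWeightSpace F e h × highestWeightSpace F e h × highestWeightSpace F e h →ₗ[F] L :=
  (highestWeightSpace F e h).subtype.coprod
    (((LieAlgebra.ad F L f).domRestrict _).coprod
      (((LieAlgebra.ad F L f) ∘ₗ (LieAlgebra.ad F L f)).domRestrict _))

theorem stringMap_apply (p : highestWeightSpace F e h × highestWeightSpace F e h ×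
    highestWeightSpace F e h) :
    stringMap F e h f p = p.1 + ⁅f, (p.2.1 : L)⁆ + ⁅f, ⁅f, (p.2.2 : L)⁆⁆ := by
  simp [stringMap, add_assoc]

/-- If the quotient of `L` by a subspace `M` is at most a line, and the members `x` and `y` of the
Lie algebra preserve `M`, then `⁅x, y⁆` acts trivially on this quotient. -/
theorem lie_lie_mem_of_codim_le_one (M : Submodule F L) {v : L}
    (hv : ∀ w, ∃ c : F, w - c • v ∈ M) {x y : L} (hx : ∀ m ∈ M, ⁅x, m⁆ ∈ M)
    (hy : ∀ m ∈ M, ⁅y, m⁆ ∈ M) (w : L) : ⁅⁅x, y⁆, w⁆ ∈ M := by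
  obtain ⟨α, hα⟩ := hv ⁅x, v⁆
  obtain ⟨β, hβ⟩ := hv ⁅y, v⁆
  obtain ⟨c, hc⟩ := hv w
  have key : ⁅⁅x, y⁆, w⁆ = ⁅x, ⁅y, w - c • v⁆⁆ - ⁅y, ⁅x, w - c • v⁆⁆
      + c • (⁅x, ⁅y, v⁆ - β • v⁆ + β • (⁅x, v⁆ - α • v) - ⁅y, ⁅x, v⁆ - α • v⁆
        - α • (⁅y, v⁆ - β • v)) := by
    simp only [lie_lie, lie_sub, lie_smul]
    module
  rw [key]
  exact M.add_mem (M.sub_mem (hx _ (hy _ hc)) (hy _ (hx _ hc))) (M.smul_mem _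
    (M.sub_mem (M.sub_mem (M.add_mem (hx _ hβ) (M.smul_mem _ hα)) (hy _ hα)) (M.smul_mem _ hβ)))

variable [CharZero F]

/-- A sum of adjoint strings of weight zero is an image `⁅f, b⁆`, which `e` does not kill unless
`b = 0`. -/
theorem eq_zero_of_lie_stringMap_eq_zero (hf : ⁅h, f⁆ = (-2 : F) • f) (hef : ⁅e, f⁆ = h)
    (p : highestWeightSpace F e h × highestWeightSpace F e h × highestWeightSpace F e h)
    (hh : ⁅h, stringMap F e h f p⁆ = 0) (he : ⁅e, stringMap F e h f p⁆ = 0) : p = 0 := by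
  obtain ⟨⟨a, ha⟩, ⟨b, hb⟩, ⟨c, hc⟩⟩ := p
  obtain ⟨ha, hea⟩ := mem_highestWeightSpace.1 ha
  obtain ⟨hb, heb⟩ := mem_highestWeightSpace.1 hb
  obtain ⟨hc, hec⟩ := mem_highestWeightSpace.1 hc
  simp only [stringMap_apply] at hh he
  simp only [lie_add, ha, lie_h_lie_f_of_weight_two hf hb,
    lie_h_lie_f_lie_f_of_weight_two hf hc, hea, lie_e_lie_f_of_weight_two hef hb heb,
    lie_e_lie_f_lie_f_of_weight_two hf hef hc hec] at hh he
  have h1 := congrArg (fun x => ⁅h, x⁆) hh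
  have h2 := congrArg (fun x => ⁅h, x⁆) he
  simp only [lie_add, lie_smul, lie_zero, ha, hb, lie_h_lie_f_of_weight_two hf hc,
    lie_h_lie_f_lie_f_of_weight_two hf hc] at h1 h2
  have two : ∀ x : L, (2 : F) • x = 0 → x = 0 := fun x hx =>
    (smul_eq_zero.1 hx).resolve_left two_ne_zero
  have a0 : a = 0 := by
    refine two _ (two _ (two _ ?_))
    linear_combination (norm := module) h1 + (2 : F) • hh
  have b0 : b = 0 := by
    refine two _ (two _ ?_)
    linear_combination (norm := module) h2
  subst a0 b0
  have c0 : c = 0 := by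
    have h3 : ⁅f, c⁆ = 0 := two _ (by simpa using he)
    have h4 := lie_e_lie_f_of_weight_two hef hc hec
    rw [h3, lie_zero] at h4
    exact two _ h4.symm
  subst c0
  rfl

theorem stringMap_injective (hf : ⁅h, f⁆ = (-2 : F) • f) (hef : ⁅e, f⁆ = h) :
    Function.Injective (stringMap F e h f) := by
  rw [injective_iff_map_eq_zero]
  intro p hp
  exact eq_zero_of_lie_stringMap_eq_zero hf hef p (by rw [hp, lie_zero]) (by rw [hp, lie_zero])

/-- Four independent highest weight vectors of weight two generate twelve dimensions. In dimension
at most thirteen, the perfect algebra `sl₂` acts trivially on the quotient by their span `M`, so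
the orthogonal of `M` consists of invariants; it meets `M` trivially. -/
theorem exists_isSl2Decomposition [FiniteDimensional F L] {B : LinearMap.BilinForm F L}
    (hB : IsInvariantScalarProduct B) (hdim : Module.finrank F L ≤ 13)
    (he : ⁅h, e⁆ = (2 : F) • e) (hf : ⁅h, f⁆ = (-2 : F) • f) (hef : ⁅e, f⁆ = h)
    (v : Fin 4 → L) (hv : LinearIndependent F v) (hvh : ∀ i, ⁅h, v i⁆ = (2 : F) • v i)
    (hve : ∀ i, ⁅e, v i⁆ = 0) (hvf : ∀ i, ⁅f, ⁅f, ⁅f, v i⁆⁆⁆ = 0) :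
    ∃ K Z : Submodule F L, IsSl2Decomposition e h f K Z ∧ Module.finrank F K = 4 ∧
      Module.finrank F L = 12 + Module.finrank F Z := by
  set K := highestWeightSpace F e h with hK
  have hinj : Function.Injective (stringMap F e h f) := stringMap_injective hf hef
  have hspan_le : Submodule.span F (Set.range v) ≤ K := by
    rw [Submodule.span_le]
    rintro _ ⟨i, rfl⟩
    exact mem_highestWeightSpace.2 ⟨hvh i, hve i⟩
  have hspan : Module.finrank F (Submodule.span F (Set.range v)) = 4 := by
    rw [finrank_span_eq_card hv, Fintype.card_fin]
  have hMK : Module.finrank F (LinearMap.range (stringMap F e h f)) = 3 * Module.finrank F K := by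
    rw [LinearMap.finrank_range_of_inj hinj, Module.finrank_prod, Module.finrank_prod]
    ring
  set M := LinearMap.range (stringMap F e h f) with hM
  have hMle := Submodule.finrank_le M
  have hKge := Submodule.finrank_mono hspan_le
  have hK4 : Module.finrank F K = 4 := by omega
  have hspan_eq : Submodule.span F (Set.range v) = K :=
    Submodule.eq_of_le_of_finrank_eq hspan_le (by omega)
  have hKf : ∀ a ∈ K, ⁅f, ⁅f, ⁅f, a⁆⁆⁆ = 0 := by
    intro a ha
    rw [← hspan_eq] at ha
    induction ha using Submodule.span_induction with
    | mem x hx => obtain ⟨i, rfl⟩ := hx; exact hvf i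
    | zero => simp
    | add x y _ _ hx hy => simp only [lie_add, hx, hy, add_zero]
    | smul c x _ hx => simp only [lie_smul, hx, smul_zero]
  have hM1 : ∀ a ∈ K, a ∈ M := fun a ha => ⟨(⟨a, ha⟩, 0, 0), by simp [stringMap_apply]⟩
  have hM2 : ∀ a ∈ K, ⁅f, a⁆ ∈ M := fun a ha => ⟨(0, ⟨a, ha⟩, 0), by simp [stringMap_apply]⟩
  have hM3 : ∀ a ∈ K, ⁅f, ⁅f, a⁆⁆ ∈ M := fun a ha =>
    ⟨(0, 0, ⟨a, ha⟩), by simp [stringMap_apply]⟩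
  have hMf : ∀ m ∈ M, ⁅f, m⁆ ∈ M := by
    rintro _ ⟨⟨⟨a, ha⟩, ⟨b, hb⟩, ⟨c, hc⟩⟩, rfl⟩
    rw [stringMap_apply, lie_add, lie_add, hKf c hc, add_zero]
    exact M.add_mem (hM2 a ha) (hM3 b hb)
  have hMe : ∀ m ∈ M, ⁅e, m⁆ ∈ M := by
    rintro _ ⟨⟨⟨a, ha⟩, ⟨b, hb⟩, ⟨c, hc⟩⟩, rfl⟩
    have hb' := mem_highestWeightSpace.1 hb
    have hc' := mem_highestWeightSpace.1 hc
    rw [stringMap_apply, lie_add, lie_add, (mem_highestWeightSpace.1 ha).2, zero_add,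
      lie_e_lie_f_of_weight_two hef hb'.1 hb'.2,
      lie_e_lie_f_lie_f_of_weight_two hf hef hc'.1 hc'.2]
    exact M.add_mem (M.smul_mem _ (hM1 b hb)) (M.smul_mem _ (hM2 c hc))
  have hMh : ∀ m ∈ M, ⁅h, m⁆ ∈ M := by
    intro m hm
    rw [← hef, lie_lie]
    exact M.sub_mem (hMe _ (hMf _ hm)) (hMf _ (hMe _ hm))
  obtain ⟨w, hw⟩ : ∃ w : L, ∀ x, ∃ c : F, x - c • w ∈ M := by
    have hquot : Module.finrank F (L ⧸ M) ≤ 1 := by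
      have := Submodule.finrank_quotient_add_finrank M
      omega
    obtain ⟨q, hq⟩ := finrank_le_one_iff.1 hquot
    obtain ⟨w, rfl⟩ := M.mkQ_surjective q
    refine ⟨w, fun x => ?_⟩
    obtain ⟨c, hc⟩ := hq (M.mkQ x)
    refine ⟨c, ?_⟩
    rw [← Submodule.Quotient.mk_eq_zero, Submodule.Quotient.mk_sub, Submodule.Quotient.mk_smul]
    exact sub_eq_zero.2 hc.symm
  have half : ∀ {x y : L} {c : F}, c ≠ 0 → ⁅h, y⁆ = c • y → ⁅⁅h, y⁆, x⁆ ∈ M → ⁅y, x⁆ ∈ M := by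
    intro x y c hc hy hx
    rw [hy, smul_lie] at hx
    exact (M.smul_mem_iff hc).1 hx
  have heL : ∀ x, ⁅e, x⁆ ∈ M := fun x =>
    half two_ne_zero he (lie_lie_mem_of_codim_le_one M hw hMh hMe x)
  have hfL : ∀ x, ⁅f, x⁆ ∈ M := fun x =>
    half (neg_ne_zero.2 two_ne_zero) hf (lie_lie_mem_of_codim_le_one M hw hMh hMf x)
  have hrefl : B.IsRefl := LinearMap.BilinForm.IsSymm.isRefl ⟨hB.symm⟩
  set Z := B.orthogonal M with hZ
  have hkill : ∀ {y : L}, (∀ x, ⁅y, x⁆ ∈ M) → ∀ z ∈ Z, ⁅y, z⁆ = 0 := by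
    intro y hy z hz
    refine hB.eq_zero fun x => ?_
    rw [hB.apply_lie_left, hB.symm, (LinearMap.BilinForm.mem_orthogonal_iff.1 hz) _ (hy x),
      neg_zero]
  have hZe := hkill heL
  have hZf := hkill hfL
  have hdisj : Disjoint M Z := by
    rw [Submodule.disjoint_def]
    rintro _ ⟨p, rfl⟩ hz
    have h1 := hZe _ hz
    have h2 := hZf _ hz
    have h3 : ⁅⁅e, f⁆, stringMap F e h f p⁆ = 0 := by
      rw [lie_lie, h1, h2, lie_zero, lie_zero, sub_zero]
    rw [hef] at h3
    rw [eq_zero_of_lie_stringMap_eq_zero hf hef p h3 h1, map_zero]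
  have hcompl : IsCompl M Z :=
    (LinearMap.BilinForm.isCompl_orthogonal_iff_disjoint hrefl).2 hdisj
  refine ⟨K, Z, ⟨he, hf, hef, fun a ha => (mem_highestWeightSpace.1 ha).1,
    fun a ha => (mem_highestWeightSpace.1 ha).2, hKf, hZe, hZf, fun x => ?_⟩, hK4, ?_⟩
  · have hx : x ∈ M ⊔ Z := hcompl.sup_eq_top ▸ Submodule.mem_top
    obtain ⟨_, ⟨⟨⟨a, ha⟩, ⟨b, hb⟩, ⟨c, hc⟩⟩, rfl⟩, z, hz, rfl⟩ := Submodule.mem_sup.1 hx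
    exact ⟨a, ha, b, hb, c, hc, z, hz, by rw [stringMap_apply]⟩
  · rw [← Submodule.finrank_add_eq_of_isCompl hcompl, hMK, hK4]

end Existence

/-! ### The coordinate ring and the current Lie algebra -/

/-- A commutative, associative and unital bilinear product on a vector space. -/
structure CommProduct (F V : Type*) [Field F] [AddCommGroup V] [Module F V] where
  mul : V →ₗ[F] V →ₗ[F] V
  one : V
  mul_comm : ∀ a b, mul a b = mul b a
  mul_assoc : ∀ a b c, mul (mul a b) c = mul a (mul b c)
  one_mul : ∀ a, mul one a = a

namespace CommProduct

variable {F V : Type*} [Field F] [AddCommGroup V] [Module F V] (P : CommProduct F V)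

/-- The underlying space, as a type which carries the ring structure given by the product. -/
def Carrier (_ : CommProduct F V) : Type _ := V

instance : AddCommGroup P.Carrier := inferInstanceAs (AddCommGroup V)

instance : Module F P.Carrier := inferInstanceAs (Module F V)

instance : CommRing P.Carrier :=
  { (inferInstance : AddCommGroup P.Carrier) with
    mul := fun a b => P.mul a b
    one := P.one
    mul_comm := P.mul_comm
    mul_assoc := P.mul_assoc
    one_mul := P.one_mul
    mul_one := fun a => (P.mul_comm a P.one).trans (P.one_mul a)
    left_distrib := fun a b c => map_add (P.mul a) b c
    right_distrib := fun a b c => LinearMap.map_add₂ P.mul a b c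
    zero_mul := fun a => LinearMap.map_zero₂ P.mul a
    mul_zero := fun a => map_zero (P.mul a) }

instance : Algebra F P.Carrier :=
  Algebra.ofModule (fun r x y => LinearMap.map_smul₂ P.mul r x y)
    (fun r x y => map_smul (P.mul x) r y)

end CommProduct

section LieHom

variable {F A S L : Type*} [Field F] [CommRing A] [Algebra F A] [LieRing S] [LieAlgebra F S]
  [LieRing L] [LieAlgebra F L]

/-- A linear map on `A ⊗ S` which respects brackets of pure tensors is a homomorphism. -/
def lieHomOfTmul (φ : A ⊗[F] S →ₗ[F] L)
    (hφ : ∀ a b x y, φ ((a * b) ⊗ₜ ⁅x, y⁆) = ⁅φ (a ⊗ₜ x), φ (b ⊗ₜ y)⁆) :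
    A ⊗[F] S →ₗ⁅F⁆ L :=
  { φ with
    map_lie' := fun {t u} => by
      change φ ⁅t, u⁆ = ⁅φ t, φ u⁆
      induction t using TensorProduct.induction_on with
      | zero => rw [zero_lie, map_zero, zero_lie]
      | add t₁ t₂ h₁ h₂ => rw [add_lie, map_add, h₁, h₂, map_add, add_lie]
      | tmul a x =>
        induction u using TensorProduct.induction_on with
        | zero => rw [lie_zero, map_zero, lie_zero]
        | add u₁ u₂ h₁ h₂ => rw [lie_add, map_add, h₁, h₂, map_add, lie_add]
        | tmul b y => exact hφ a b x y }

end LieHom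

section SL2

-- matrices do not carry the commutator bracket as a global instance
attribute [local instance] LieRing.ofAssociativeRing

variable {F : Type*} [Field F]

/-- The matrix entries of an element of `sl₂`. -/
def sl2Entry (i j : Fin 2) : SL2 F →ₗ[F] F where
  toFun x := x.1 i j
  map_add' _ _ := rfl
  map_smul' _ _ := rfl

/-- The traceless matrix with rows `(a, b)` and `(c, -a)`. -/
def sl2Mk (a b c : F) : SL2 F := ⟨!![a, b; c, -a], by
  change Matrix.trace !![a, b; c, -a] = 0
  simp [Matrix.trace_fin_two]⟩

theorem sl2_ext {x y : SL2 F} (h00 : sl2Entry 0 0 x = sl2Entry 0 0 y)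
    (h01 : sl2Entry 0 1 x = sl2Entry 0 1 y) (h10 : sl2Entry 1 0 x = sl2Entry 1 0 y) : x = y := by
  have hx : Matrix.trace x.1 = 0 := x.2
  have hy : Matrix.trace y.1 = 0 := y.2
  rw [Matrix.trace_fin_two] at hx hy
  apply Subtype.ext
  ext i j
  fin_cases i <;> fin_cases j
  · exact h00
  · exact h01
  · exact h10
  · have h00' : x.1 0 0 = y.1 0 0 := h00
    change x.1 1 1 = y.1 1 1
    linear_combination hx - hy - h00'

theorem sl2Entry_one_one (x : SL2 F) : sl2Entry 1 1 x = -sl2Entry 0 0 x := by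
  have hx : Matrix.trace x.1 = 0 := x.2
  rw [Matrix.trace_fin_two] at hx
  exact eq_neg_of_add_eq_zero_right hx

theorem sl2Entry_lie (i j : Fin 2) (x y : SL2 F) : sl2Entry i j ⁅x, y⁆ =
    sl2Entry i 0 x * sl2Entry 0 j y + sl2Entry i 1 x * sl2Entry 1 j y -
      (sl2Entry i 0 y * sl2Entry 0 j x + sl2Entry i 1 y * sl2Entry 1 j x) := by
  change (x.1 * y.1 - y.1 * x.1) i j = _
  rw [Matrix.sub_apply, Matrix.mul_apply, Matrix.mul_apply, Fin.sum_univ_two, Fin.sum_univ_two]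
  rfl

@[simp] theorem sl2Entry_mk_zero_zero (a b c : F) : sl2Entry 0 0 (sl2Mk a b c) = a := rfl

@[simp] theorem sl2Entry_mk_zero_one (a b c : F) : sl2Entry 0 1 (sl2Mk a b c) = b := rfl

@[simp] theorem sl2Entry_mk_one_zero (a b c : F) : sl2Entry 1 0 (sl2Mk a b c) = c := rfl

theorem lie_sl2Mk (a b c a' b' c' : F) : ⁅sl2Mk a b c, sl2Mk a' b' c'⁆ =
    sl2Mk (b * c' - b' * c) (2 * (a * b' - a' * b)) (2 * (c * a' - c' * a)) := by
  refine sl2_ext ?_ ?_ ?_ <;> simp [sl2Entry_lie, sl2Entry_one_one] <;> ring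

theorem smul_sl2Mk (t a b c : F) : t • sl2Mk a b c = sl2Mk (t * a) (t * b) (t * c) := by
  refine sl2_ext ?_ ?_ ?_ <;> simp

theorem finrank_sl2_le : Module.finrank F (SL2 F) ≤ 3 := by
  let φ : SL2 F →ₗ[F] Fin 3 → F :=
    LinearMap.pi ![sl2Entry 0 0, sl2Entry 0 1, sl2Entry 1 0]
  have hφ : Function.Injective φ := fun x y h =>
    sl2_ext (congrFun h 0) (congrFun h 1) (congrFun h 2)
  simpa using LinearMap.finrank_le_finrank_of_injective hφ

end SL2

namespace IsSl2Decomposition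

variable {F : Type*} [Field F] [CharZero F] {L : Type*} [LieRing L] [LieAlgebra F L]
  {e h f : L} {K Z : Submodule F L}

/-- The map sending `a ⊗ e`, `a ⊗ h`, `a ⊗ f` to the string of the highest weight vector `g a`. The
coefficients are those of `⁅f, e⁆ = -h` and `⁅f, ⁅f, e⁆⁆ = -2 • f` in `sl₂`. -/
def currentMap {A : Type*} [CommRing A] [Algebra F A] (f : L) (g : A →ₗ[F] L) :
    SL2Tensor F A →ₗ[F] L :=
  TensorProduct.lift (LinearMap.mk₂ F
    (fun a x => sl2Entry 0 1 x • g a - sl2Entry 0 0 x • ⁅f, g a⁆ -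
      (2⁻¹ * sl2Entry 1 0 x) • ⁅f, ⁅f, g a⁆⁆)
    (fun a b x => by simp only [map_add, lie_add]; module)
    (fun c a x => by simp only [map_smul, lie_smul]; module)
    (fun a x y => by simp only [map_add]; module)
    (fun c a x => by simp only [map_smul, smul_eq_mul]; module))

theorem currentMap_tmul {A : Type*} [CommRing A] [Algebra F A] (f : L) (g : A →ₗ[F] L) (a : A)
    (x : SL2 F) : currentMap f g (a ⊗ₜ[F] x) =
      sl2Entry 0 1 x • g a - sl2Entry 0 0 x • ⁅f, g a⁆ -
        (2⁻¹ * sl2Entry 1 0 x) • ⁅f, ⁅f, g a⁆⁆ := rfl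

/-- The brackets between the strings of two highest weight vectors `p` and `q` with coordinate
product `r`, in the absence of invariants. All of them follow from `⁅p, ⁅f, q⁆⁆ = 2 • r` by
applying `ad f`. -/
theorem lie_strings (H : IsSl2Decomposition e h f K ⊥) {p q r : L} (hp : p ∈ K) (hq : q ∈ K)
    (hr : r ∈ K) (hpq : ⁅p, ⁅f, q⁆⁆ = (2 : F) • r) :
    ⁅⁅f, p⁆, q⁆ = (-2 : F) • r ∧ ⁅⁅f, p⁆, ⁅f, q⁆⁆ = 0 ∧
    ⁅p, ⁅f, ⁅f, q⁆⁆⁆ = (2 : F) • ⁅f, r⁆ ∧ ⁅⁅f, ⁅f, p⁆⁆, q⁆ = (-2 : F) • ⁅f, r⁆ ∧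
    ⁅⁅f, p⁆, ⁅f, ⁅f, q⁆⁆⁆ = (2 : F) • ⁅f, ⁅f, r⁆⁆ ∧
    ⁅⁅f, ⁅f, p⁆⁆, ⁅f, q⁆⁆ = (-2 : F) • ⁅f, ⁅f, r⁆⁆ ∧ ⁅⁅f, ⁅f, p⁆⁆, ⁅f, ⁅f, q⁆⁆⁆ = 0 := by
  have h1 : ⁅⁅f, p⁆, q⁆ = (-2 : F) • r := by
    rw [← lie_skew, ← H.lie_lie_f_comm hp hq, hpq, neg_smul]
  have h2 : ⁅⁅f, p⁆, ⁅f, q⁆⁆ = 0 := (Submodule.mem_bot F).1 (H.lie_lie_f_lie_f_mem hp hq)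
  have h3 : ⁅p, ⁅f, ⁅f, q⁆⁆⁆ = (2 : F) • ⁅f, r⁆ := by
    rw [← lie_smul, ← hpq, leibniz_lie f p, h2, zero_add]
  have h4 : ⁅⁅f, ⁅f, p⁆⁆, q⁆ = (-2 : F) • ⁅f, r⁆ := by
    rw [← lie_smul, ← h1, leibniz_lie f ⁅f, p⁆, h2, add_zero]
  have h5 : ⁅⁅f, p⁆, ⁅f, ⁅f, q⁆⁆⁆ = (2 : F) • ⁅f, ⁅f, r⁆⁆ := by
    rw [← lie_smul, ← h3, leibniz_lie f p, H.lie_f_lie_f_lie_f q hq, lie_zero, add_zero]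
  have h6 : ⁅⁅f, ⁅f, p⁆⁆, ⁅f, q⁆⁆ = (-2 : F) • ⁅f, ⁅f, r⁆⁆ := by
    rw [← lie_smul, ← h4, leibniz_lie f ⁅f, ⁅f, p⁆⁆, H.lie_f_lie_f_lie_f p hp, zero_lie, zero_add]
  refine ⟨h1, h2, h3, h4, h5, h6, ?_⟩
  have h7 : ⁅f, ⁅⁅f, p⁆, ⁅f, ⁅f, q⁆⁆⁆⁆ = ⁅⁅f, ⁅f, p⁆⁆, ⁅f, ⁅f, q⁆⁆⁆ := by
    rw [leibniz_lie f ⁅f, p⁆, H.lie_f_lie_f_lie_f q hq, lie_zero, add_zero]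
  rw [← h7, h5, lie_smul, H.lie_f_lie_f_lie_f r hr, smul_zero]

theorem currentMap_lie (H : IsSl2Decomposition e h f K ⊥) {A : Type*} [CommRing A] [Algebra F A]
    (g : A →ₗ[F] L) (hgK : ∀ a, g a ∈ K) (hg : ∀ a b, ⁅g a, ⁅f, g b⁆⁆ = (2 : F) • g (a * b))
    (a b : A) (x y : SL2 F) : currentMap f g ((a * b) ⊗ₜ[F] ⁅x, y⁆) =
      ⁅currentMap f g (a ⊗ₜ[F] x), currentMap f g (b ⊗ₜ[F] y)⁆ := by
  obtain ⟨h1, h2, h3, h4, h5, h6, h7⟩ := H.lie_strings (hgK a) (hgK b) (hgK (a * b)) (hg a b)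
  simp only [currentMap_tmul, lie_sub, sub_lie, lie_smul, smul_lie,
    H.lie_eq_zero (hgK a) (hgK b), hg, h1, h2, h3, h4, h5, h6, h7, sl2Entry_lie, sl2Entry_one_one]
  module

/-- A Lie algebra without invariants is the current algebra of its coordinate algebra. -/
theorem nonempty_lieEquiv_sl2Tensor [FiniteDimensional F L] (H : IsSl2Decomposition e h f K ⊥)
    (hL : Module.finrank F L = 3 * Module.finrank F K) {A : Type*} [CommRing A] [Algebra F A]
    (φ : A ≃ₗ[F] K) (hφ : ∀ a b, φ (a * b) = H.mul (φ a) (φ b)) :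
    Nonempty (L ≃ₗ⁅F⁆ SL2Tensor F A) := by
  let g : A →ₗ[F] L := K.subtype.comp φ.toLinearMap
  have hgK : ∀ a, g a ∈ K := fun a => (φ a).2
  have hg : ∀ a b, ⁅g a, ⁅f, g b⁆⁆ = (2 : F) • g (a * b) := by
    intro a b
    change _ = (2 : F) • ((φ (a * b) : K) : L)
    rw [hφ, coe_mul, smul_inv_smul₀ two_ne_zero]
    rfl
  let Φ : SL2Tensor F A →ₗ⁅F⁆ L :=
    lieHomOfTmul (currentMap f g) (H.currentMap_lie g hgK hg)
  have hsurj : Function.Surjective (currentMap f g) := by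
    intro x
    obtain ⟨a, ha, b, hb, c, hc, z, hz, rfl⟩ := H.exists_eq x
    rw [Submodule.mem_bot] at hz
    refine ⟨φ.symm ⟨a, ha⟩ ⊗ₜ sl2Mk 0 1 0 - φ.symm ⟨b, hb⟩ ⊗ₜ sl2Mk 1 0 0
      - (2 : F) • φ.symm ⟨c, hc⟩ ⊗ₜ sl2Mk 0 0 1, ?_⟩
    simp only [map_sub, map_smul, currentMap_tmul, sl2Entry_mk_zero_zero, sl2Entry_mk_zero_one,
      sl2Entry_mk_one_zero, g, LinearMap.comp_apply, LinearEquiv.coe_coe,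
      LinearEquiv.apply_symm_apply, Submodule.subtype_apply, hz]
    module
  have : FiniteDimensional F A := Module.Finite.equiv φ.symm
  have hle : Module.finrank F (SL2Tensor F A) ≤ Module.finrank F L := by
    rw [Module.finrank_tensorProduct, φ.finrank_eq, hL, mul_comm]
    exact Nat.mul_le_mul_right _ finrank_sl2_le
  have heq : Module.finrank F (SL2Tensor F A) = Module.finrank F L := by
    have := LinearMap.finrank_range_le (currentMap f g)
    rw [LinearMap.range_eq_top.2 hsurj, finrank_top] at this
    exact le_antisymm hle this
  have hinj := (LinearMap.injective_iff_surjective_of_finrank_eq_finrank heq).2 hsurj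
  exact ⟨(LieEquiv.ofBijective Φ ⟨hinj, hsurj⟩).symm⟩

end IsSl2Decomposition

/-! ### The radical and the maximal ideal of the coordinate algebra -/

namespace IsSl2Decomposition

variable {F : Type*} [Field F] {L : Type*} [LieRing L] [LieAlgebra F L]
  {e h f : L} {K Z : Submodule F L}

/-- The highest weight vectors inside an ideal. -/
def trace (K : Submodule F L) (I : LieIdeal F L) : Submodule F K := I.toSubmodule.comap K.subtype

theorem mem_trace {I : LieIdeal F L} {a : K} : a ∈ trace K I ↔ (a : L) ∈ I := Iff.rfl

theorem exists_derivedSeriesOfIdeal_radical_eq_bot (F L : Type*) [Field F] [LieRing L]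
    [LieAlgebra F L] [FiniteDimensional F L] :
    ∃ k, LieAlgebra.derivedSeriesOfIdeal F L k (LieAlgebra.radical F L) = ⊥ := by
  obtain ⟨k, hk⟩ := LieAlgebra.IsSolvable.solvable F (LieAlgebra.radical F L)
  exact ⟨k, (LieIdeal.derivedSeries_eq_bot_iff _ k).1 hk⟩

variable [CharZero F]

theorem mul_mem_trace (H : IsSl2Decomposition e h f K Z) (I : LieIdeal F L) (a : K) {n : K}
    (hn : n ∈ trace K I) : H.mul a n ∈ trace K I := by
  rw [mem_trace, coe_mul]
  exact I.smul_mem _ (lie_mem_right F L I _ _ (lie_mem_right F L I _ _ hn))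

theorem der_mem_trace (H : IsSl2Decomposition e h f K Z) (I : LieIdeal F L) {z : L} (hz : z ∈ Z)
    {n : K} (hn : n ∈ trace K I) : H.der hz n ∈ trace K I :=
  lie_mem_right F L I _ _ hn

/-- Squaring moves the coordinates of an ideal into those of its derived ideal. -/
theorem sq_mem_derivedSeriesOfIdeal (H : IsSl2Decomposition e h f K Z) (I : LieIdeal F L) {k : ℕ}
    {n : K} (hn : (n : L) ∈ LieAlgebra.derivedSeriesOfIdeal F L k I) :
    (H.mul n n : L) ∈ LieAlgebra.derivedSeriesOfIdeal F L (k + 1) I := by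
  rw [LieAlgebra.derivedSeriesOfIdeal_succ, coe_mul]
  exact Submodule.smul_mem (LieSubmodule.toSubmodule _) _
    (LieSubmodule.lie_mem_lie hn (lie_mem_right F L _ _ _ hn))

/-- An idempotent in the radical lies in every term of its derived series. -/
theorem eq_zero_of_mul_self_eq (H : IsSl2Decomposition e h f K Z) [FiniteDimensional F L] {n : K}
    (hn : n ∈ trace K (LieAlgebra.radical F L)) (hnn : H.mul n n = n) : n = 0 := by
  obtain ⟨k, hk⟩ := exists_derivedSeriesOfIdeal_radical_eq_bot F L
  have hmem : ∀ j, (n : L) ∈ LieAlgebra.derivedSeriesOfIdeal F L j (LieAlgebra.radical F L) := by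
    intro j
    induction j with
    | zero => exact hn
    | succ j ih => rw [← hnn]; exact H.sq_mem_derivedSeriesOfIdeal _ ih
  have := hmem k
  rw [hk, LieSubmodule.mem_bot] at this
  exact Subtype.ext this

/-- A highest weight vector is the sum of a multiple of `e` and of an element of the radical. -/
theorem exists_sub_smul_mem_trace_radical (H : IsSl2Decomposition e h f K Z) (he : e ≠ 0)
    (s : LieSubalgebra F L) (hs : IsLeviSubalgebra s) (hh : h ∈ s)
    (hspan : ∀ x ∈ s, ∃ a b c : F, x = a • e + b • h + c • f) (x : K) :
    ∃ c : F, x - c • (⟨e, H.e_mem⟩ : K) ∈ trace K (LieAlgebra.radical F L) := by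
  obtain ⟨σ, hσ, ρ, hρ, hx⟩ := Submodule.mem_sup.1
    (show (x : L) ∈ s.toSubmodule ⊔ (LieAlgebra.radical F L).toSubmodule from
      hs.sup_eq_top ▸ Submodule.mem_top)
  have hσw : ⁅h, σ⁆ = (2 : F) • σ := by
    have h1 : ⁅h, σ⁆ - (2 : F) • σ = (2 : F) • ρ - ⁅h, ρ⁆ := by
      have h2 := H.lie_h x x.2
      rw [← hx, lie_add, smul_add] at h2
      linear_combination (norm := module) h2
    have h3 : ⁅h, σ⁆ - (2 : F) • σ ∈ s.toSubmodule :=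
      Submodule.sub_mem _ (s.lie_mem hh hσ) (Submodule.smul_mem _ _ hσ)
    have h4 : ⁅h, σ⁆ - (2 : F) • σ ∈ (LieAlgebra.radical F L).toSubmodule := by
      rw [h1]
      exact Submodule.sub_mem _ (Submodule.smul_mem _ _ hρ) (lie_mem_right F L _ _ _ hρ)
    exact sub_eq_zero.1 (Submodule.disjoint_def.1 hs.disjoint _ h3 h4)
  obtain ⟨a, b, c, rfl⟩ := hspan σ hσ
  have hbc : (0 : L) = b • h + (2 * c) • f := by
    simp only [lie_add, lie_smul, H.lie_h_e, H.lie_h_f, lie_self] at hσw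
    have h2 : (2 : F) • (b • h + (2 * c) • f) = 0 := by
      linear_combination (norm := module) -hσw
    exact ((smul_eq_zero.1 h2).resolve_left two_ne_zero).symm
  have heh : ⁅e, h⁆ = (-2 : F) • e := by rw [← lie_skew, H.lie_h_e, neg_smul]
  have hb : b = 0 ∧ c = 0 := by
    have h1 := congrArg (fun y => ⁅e, y⁆) hbc
    simp only [lie_zero, lie_add, lie_smul, heh, H.lie_e_f] at h1
    have h2 := congrArg (fun y => ⁅e, y⁆) h1
    simp only [lie_zero, lie_add, lie_smul, heh, lie_self] at h2
    have hc : c = 0 := by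
      have h3 : (4 * c) • e = 0 := by linear_combination (norm := module) h2
      simpa using (smul_eq_zero.1 h3).resolve_right he
    refine ⟨?_, hc⟩
    rw [hc] at h1
    have h3 : (2 * b) • e = 0 := by linear_combination (norm := module) h1
    simpa using (smul_eq_zero.1 h3).resolve_right he
  refine ⟨a, ?_⟩
  rw [mem_trace, Submodule.coe_sub, Submodule.coe_smul, ← hx, hb.1, hb.2, zero_smul, zero_smul,
    add_zero, add_zero, add_sub_cancel_left]
  exact hρ

/-- In the presence of a single invariant `d`, the bracket of `d` measures the associativity defect
of the coordinate algebra, hence vanishes; the line spanned by `d` is then a nondegenerate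
ideal. -/
theorem not_isIrreducibleQuadratic [IsAlgClosed F] [FiniteDimensional F L]
    (H : IsSl2Decomposition e h f K Z) (hK : Module.finrank F K = 4)
    (hZ : Module.finrank F Z = 1) (he : e ≠ 0) {B : LinearMap.BilinForm F L}
    (hB : IsInvariantScalarProduct B) (heR : e ∉ LieAlgebra.radical F L)
    (hN : ∀ x : K, ∃ c : F, x - c • (⟨e, H.e_mem⟩ : K) ∈ trace K (LieAlgebra.radical F L)) :
    ¬ IsIrreducibleQuadratic B := by
  intro hirr
  obtain ⟨⟨d, hd⟩, hd0, hdZ⟩ := finrank_eq_one_iff'.1 hZ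
  have hd0' : d ≠ 0 := fun h0 => hd0 (Subtype.ext h0)
  have hdZ' : ∀ z ∈ Z, ∃ c : F, c • d = z := fun z hz => by
    obtain ⟨c, hc⟩ := hdZ ⟨z, hz⟩
    exact ⟨c, congrArg Subtype.val hc⟩
  have hdd : B d d ≠ 0 := fun h0 => hd0' (H.eq_zero_of_mem_of_apply_eq_zero hB hd fun w hw => by
    obtain ⟨c, rfl⟩ := hdZ' w hw
    rw [map_smul, h0, smul_zero])
  have hD : H.der hd = 0 := by
    refine skewDerivation_eq_zero hK H.mul H.mul_comm' ⟨e, H.e_mem⟩ H.e_mul (form f K B)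
      (H.form_nondegenerate hB) (form_comm hB) (H.form_mul hB) (H.der hd) (H.der_mul hd)
      (H.form_der hB hd) (H.der_e hd) (trace K (LieAlgebra.radical F L)) hN heR
      (fun x n hn => H.mul_mem_trace _ x hn) (fun n hn => H.der_mem_trace _ hd hn)
      (fun n hn => H.eq_zero_of_mul_self_eq hn) (-(4 * B d d)⁻¹)
      (neg_ne_zero.2 (inv_ne_zero (mul_ne_zero (by norm_num) hdd))) fun a b c => ?_
    obtain ⟨t, ht⟩ := hdZ' _ (H.lie_lie_f_lie_f_mem a.2 b.2)
    have h1 := H.apply_lie_lie_f_lie_f hB hd a b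
    rw [← ht, map_smul, LinearMap.smul_apply, smul_eq_mul] at h1
    refine Subtype.ext ?_
    rw [mul_mul_sub_mul_mul, ← ht, Submodule.coe_smul, coe_der, smul_lie, smul_smul]
    congr 1
    rw [← neg_eq_iff_eq_neg] at h1
    rw [← h1]
    field_simp
  have hdK : ∀ a ∈ K, ⁅d, a⁆ = 0 := fun a ha =>
    congrArg Subtype.val (LinearMap.congr_fun hD ⟨a, ha⟩)
  have hcentral : ∀ x : L, ⁅d, x⁆ = 0 := by
    intro x
    obtain ⟨a, ha, b, hb, c, hc, z, hz, rfl⟩ := H.exists_eq x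
    obtain ⟨t, rfl⟩ := hdZ' z hz
    rw [lie_add, lie_add, lie_add, ← H.lie_f_lie_of_mem hd, ← H.lie_f_lie_of_mem hd,
      ← H.lie_f_lie_of_mem hd, hdK a ha, hdK b hb, hdK c hc, lie_smul, lie_self]
    simp
  let I : LieIdeal F L :=
    { Submodule.span F {d} with
      lie_mem := fun {x m} hm => by
        obtain ⟨c, rfl⟩ := Submodule.mem_span_singleton.1 hm
        rw [lie_smul, ← lie_skew, hcentral, neg_zero, smul_zero]
        exact Submodule.zero_mem _ }
  have hdI : d ∈ I := Submodule.mem_span_singleton_self d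
  have hI : IsNondegenerateIdeal B I := by
    refine LinearMap.BilinForm.nondegenerate_restrict_of_disjoint_orthogonal B
      (LinearMap.BilinForm.IsSymm.isRefl ⟨hB.symm⟩) ?_
    rw [Submodule.disjoint_def]
    intro x hx hx'
    obtain ⟨c, rfl⟩ := Submodule.mem_span_singleton.1 (show x ∈ Submodule.span F {d} from hx)
    have h1 := LinearMap.BilinForm.mem_orthogonal_iff.1 hx' d hdI
    have h2 : c * B d d = 0 := by rw [← smul_eq_mul, ← map_smul]; exact h1
    rw [(mul_eq_zero.1 h2).resolve_right hdd, zero_smul]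
  rcases hirr I hI with h0 | h1
  · rw [h0, LieSubmodule.mem_bot] at hdI
    exact hd0' hdI
  · have heI : e ∈ I := h1 ▸ LieSubmodule.mem_top e
    obtain ⟨c, hc⟩ := Submodule.mem_span_singleton.1
      (show e ∈ Submodule.span F {d} from heI)
    have h2 := H.lie_h_e
    rw [← hc, lie_smul, H.lie_h_invariant hd, smul_zero] at h2
    exact he (hc ▸ (smul_eq_zero.1 h2.symm).resolve_left two_ne_zero)

/-- Without invariants the coordinate algebra is associative, and the classification of
four-dimensional local algebras with an invariant form applies to it. -/
theorem sl2Tensor_classification [IsAlgClosed F] [FiniteDimensional F L]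
    (H : IsSl2Decomposition e h f K ⊥) (hK : Module.finrank F K = 4)
    (hL : Module.finrank F L = 12) {B : LinearMap.BilinForm F L}
    (hB : IsInvariantScalarProduct B)
    (hN : ∀ x : K, ∃ c : F, x - c • (⟨e, H.e_mem⟩ : K) ∈ trace K (LieAlgebra.radical F L)) :
    Nonempty (L ≃ₗ⁅F⁆ SL2Tensor F (TruncPoly F)) ∨
      Nonempty (L ≃ₗ⁅F⁆ SL2Tensor F (TruncBiPoly F)) := by
  have hcomm : ∀ a b c : K, H.mul a (H.mul b c) = H.mul b (H.mul a c) := fun a b c =>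
    sub_eq_zero.1 (Subtype.ext (by
      rw [mul_mul_sub_mul_mul, (Submodule.mem_bot F).1 (H.lie_lie_f_lie_f_mem a.2 b.2), zero_lie,
        smul_zero, Submodule.coe_zero]))
  let P : CommProduct F K :=
    { mul := H.mul
      one := ⟨e, H.e_mem⟩
      mul_comm := H.mul_comm'
      mul_assoc := fun a b c => by
        rw [H.mul_comm' _ c, hcomm, H.mul_comm' c b]
      one_mul := H.e_mul }
  obtain ⟨k, hk⟩ := exists_derivedSeriesOfIdeal_radical_eq_bot F L
  let N : Ideal P.Carrier :=
    { (trace K (LieAlgebra.radical F L)).toAddSubmonoid with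
      smul_mem' := fun a n hn => H.mul_mem_trace _ a hn }
  have hnil : ∀ n ∈ N, IsNilpotent n := by
    intro n hn
    have hmem : ∀ j, ((n ^ 2 ^ j : P.Carrier) : K).1 ∈
        LieAlgebra.derivedSeriesOfIdeal F L j (LieAlgebra.radical F L) := by
      intro j
      induction j with
      | zero => rw [pow_zero, pow_one]; exact hn
      | succ j ih =>
        rw [pow_succ, pow_mul, sq]
        exact H.sq_mem_derivedSeriesOfIdeal _ ih
    have h0 := hmem k
    rw [hk, LieSubmodule.mem_bot] at h0
    exact ⟨2 ^ k, Subtype.ext h0⟩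
  have model : ∀ {A : Type _} [CommRing A] [Algebra F A], Nonempty (A ≃ₐ[F] P.Carrier) →
      Nonempty (L ≃ₗ⁅F⁆ SL2Tensor F A) := by
    rintro A _ _ ⟨ψ⟩
    exact H.nonempty_lieEquiv_sl2Tensor (by rw [hK, hL]) (A := A)
      (ψ.toLinearEquiv : A ≃ₗ[F] P.Carrier) (map_mul ψ)
  refine (frobenius_algebra_four_classification (R := P.Carrier) hK N hN hnil (form f K B)
    (H.form_nondegenerate hB) (form_comm hB) fun a b c => ?_).imp model model
  exact (congrArg (fun t => form f K B t c) (H.mul_comm' a b)).trans (H.form_mul hB b a c)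

end IsSl2Decomposition

theorem mainTheorem5 {F : Type*} [Field F] [IsAlgClosed F] [CharZero F]
    {L : Type*} [LieRing L] [LieAlgebra F L] [FiniteDimensional F L]
    (B : LinearMap.BilinForm F L) (hB : IsInvariantScalarProduct B)
    (hirr : IsIrreducibleQuadratic B)
    (hsolv : ¬ LieAlgebra.IsSolvable L) (hsimple : ¬ LieAlgebra.IsSimple F L)
    (hdim : Module.finrank F L ≤ 13)
    (s : LieSubalgebra F L) (hs : IsLeviSubalgebra s) (hsl2 : Nonempty (s ≃ₗ⁅F⁆ SL2 F))
    (hadj : ContainsAdjointCopies s 4) :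
    Nonempty (L ≃ₗ⁅F⁆ SL2Tensor F (TruncPoly F)) ∨
      Nonempty (L ≃ₗ⁅F⁆ SL2Tensor F (TruncBiPoly F)) := by
  obtain ⟨ι⟩ := hsl2
  obtain ⟨N, hNind, hNiso⟩ := hadj
  let τ := fun i => (hNiso i).some
  -- `x 0 1 0`, `x 1 0 0`, `x 0 0 1` is the standard triple `e, h, f` of the Levi subalgebra
  let x := fun a b c : F => ι.symm (sl2Mk a b c)
  have lie_x : ∀ a b c a' b' c', ⁅x a b c, x a' b' c'⁆ =
      x (b * c' - b' * c) (2 * (a * b' - a' * b)) (2 * (c * a' - c' * a)) :=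
    fun a b c a' b' c' => by rw [← LieEquiv.map_lie, lie_sl2Mk]
  have smul_x : ∀ t a b c, t • x a b c = x (t * a) (t * b) (t * c) := fun t a b c => by
    rw [← map_smul, smul_sl2Mk]
  have x_zero : x 0 0 0 = 0 := by
    rw [← map_zero ι.symm]
    exact congrArg ι.symm (sl2_ext rfl rfl rfl)
  have x_ne : x 0 1 0 ≠ 0 := fun h0 => by
    have h1 := congrArg (fun y => sl2Entry 0 1 (ι y)) (h0.trans x_zero.symm)
    simp [x] at h1
  have he : ⁅(x 1 0 0 : L), (x 0 1 0 : L)⁆ = (2 : F) • (x 0 1 0 : L) := by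
    refine congrArg Subtype.val (show ⁅x 1 0 0, x 0 1 0⁆ = (2 : F) • x 0 1 0 from ?_)
    rw [lie_x, smul_x]
    norm_num
  have hf : ⁅(x 1 0 0 : L), (x 0 0 1 : L)⁆ = (-2 : F) • (x 0 0 1 : L) := by
    refine congrArg Subtype.val (show ⁅x 1 0 0, x 0 0 1⁆ = (-2 : F) • x 0 0 1 from ?_)
    rw [lie_x, smul_x]
    norm_num
  have hef : ⁅(x 0 1 0 : L), (x 0 0 1 : L)⁆ = x 1 0 0 := by
    refine congrArg Subtype.val (show ⁅x 0 1 0, x 0 0 1⁆ = x 1 0 0 from ?_)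
    rw [lie_x]
    norm_num
  have hspan : ∀ y ∈ s, ∃ a b c : F,
      y = a • (x 0 1 0 : L) + b • (x 1 0 0 : L) + c • (x 0 0 1 : L) := by
    intro y hy
    have h0 : (⟨y, hy⟩ : s) = sl2Entry 0 1 (ι ⟨y, hy⟩) • x 0 1 0 +
        sl2Entry 0 0 (ι ⟨y, hy⟩) • x 1 0 0 + sl2Entry 1 0 (ι ⟨y, hy⟩) • x 0 0 1 := by
      apply ι.injective
      simp only [map_add, map_smul, x]
      refine sl2_ext ?_ ?_ ?_ <;> simp
    exact ⟨_, _, _, congrArg Subtype.val h0⟩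
  -- the highest weight vectors of the four copies of the adjoint module
  let w := fun (i : Fin 4) (y : s) => (((τ i).symm y : N i) : L)
  have lie_w : ∀ i (y z : s), ⁅(y : L), w i z⁆ = w i ⁅y, z⁆ := fun i y z =>
    congrArg Subtype.val ((τ i).symm.toLieModuleHom.map_lie y z).symm
  have smul_w : ∀ i (t : F) (y : s), t • w i y = w i (t • y) := fun i t y => by
    simp only [w]
    rw [map_smul]
    rfl
  have w_zero : ∀ i, w i 0 = 0 := fun i => by
    simp only [w]
    rw [map_zero]
    rfl
  have hli : LinearIndependent F fun i => w i (x 0 1 0) := by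
    refine (LieSubmodule.iSupIndep_toSubmodule.2 hNind).linearIndependent _
      (fun i => ((τ i).symm (x 0 1 0)).2) fun i h0 => x_ne ?_
    have h1 : (τ i).symm (x 0 1 0) = 0 := Subtype.ext h0
    rw [← map_zero (τ i).symm] at h1
    exact (τ i).symm.injective h1
  obtain ⟨K, Z, H, hK, hL⟩ := exists_isSl2Decomposition hB hdim he hf hef
    (fun i => w i (x 0 1 0)) hli
    (fun i => by rw [lie_w, smul_w, lie_x, smul_x]; norm_num)
    (fun i => by rw [lie_w, lie_x]; norm_num [x_zero, w_zero])
    (fun i => by rw [lie_w, lie_w, lie_w, lie_x, lie_x, lie_x]; norm_num [x_zero, w_zero])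
  have he0 : (x 0 1 0 : L) ≠ 0 := fun h0 => x_ne (Subtype.ext h0)
  have heR : (x 0 1 0 : L) ∉ LieAlgebra.radical F L := fun h0 =>
    he0 (Submodule.disjoint_def.1 hs.disjoint _ (x 0 1 0).2 h0)
  have hN := H.exists_sub_smul_mem_trace_radical he0 s hs (x 1 0 0).2 hspan
  rcases Nat.eq_zero_or_pos (Module.finrank F Z) with hZ | hZ
  · obtain rfl : Z = ⊥ := Submodule.finrank_eq_zero.1 hZ
    exact H.sl2Tensor_classification hK (by omega) hB hN
  · exact absurd hirr (H.not_isIrreducibleQuadratic hK (by omega) he0 hB heR hN)
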